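/- Let $k$ be a field with a nontrivial absolute value (archimedean or not), $k_c$ its completion, and $\tilde k$ the completion of an algebraic closure of $k_c$; let $\overline{k}$ be the algebraic closure of $k$ in $\tilde k$. Domains and analytic functions. If the absolute value is archimedean, a domain is a nonempty connected open subset of $\tilde k$, and a function on it is analytic if it has a convergent power series expansion around each point. If it is ultrametric, call holed disc a set $\{|z-a|\le r\}\setminus\bigcup_{j=1}^m\{|z-c_j|<s_j\}$ with $m\ge 0$ and $r,s_j\in|\tilde k^{\times}|$; a domain is a nonempty subset $\mathcal U\subseteq\tilde k$ any two points of which lie in a common holed disc contained in $\mathcal U$, and a function is analytic on $\mathcal U$ if on each holed disc contained in $\mathcal U$ it is a uniform limit of rational functions without poles there (for example, a function given by a power series converging on an open disc centred at the origin is analytic on that disc). Let $f_1,\dots,f_n$ be analytic functions on a domain $\mathcal U\subseteq\tilde k$ with $0\in\mathcal U$, whose power series expansions at $0$ have coefficients in $\overline{k}$. Regard them as elements of $\overline{k}((z))$. A finitely generated field extension $E/K$ is called regular if there is a transcendence basis $B$ of $E$ over $K$ such that $E$ is separable algebraic over $K(B)$, and every element of $E$ algebraic over $K$ lies in $K$.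 Put $$\mathfrak p=\{Q\in\overline{k}(z)[X_1,\dots,X_n] : Q(z,f_1(z),\dots,f_n(z))=0\}$$ and, for $\alpha\in\mathcal U\cap\overline{k}$, $$\mathfrak p_\alpha=\{P\in\overline{k}[X_1,\dots,X_n] : P(f_1(\alpha),\dots,f_n(\alpha))=0\}.$$ For an ideal $\mathfrak q$ of $R[X_1,\dots,X_n]$ let $\tilde{\mathfrak q}$ be the ideal of $R[X_0,\dots,X_n]$ generated by the homogeneous polynomials $Q$ with $Q(1,X_1,\dots,X_n)\in\mathfrak q$, and let $\mathrm{ev}_\alpha$ denote evaluation at $z=\alpha$. Suppose that $\overline{k}(z)(f_1,\dots,f_n)$ is not regular over $\overline{k}(z)$. Then for every $\alpha\in\mathcal U\cap\overline{k}$, $$\mathrm{ev}_\alpha\bigl(\tilde{\mathfrak p}\cap\overline{k}[z][X_0,\dots,X_n]\bigr)\subsetneq\tilde{\mathfrak p}_\alpha .$$ In other words, not every homogeneous relation over $\overline{k}$ between $1,f_1(\alpha),\dots,f_n(\alpha)$ lifts: there is a homogeneous $P\in\overline{k}[X_0,\dots,X_n]$ with $P(1,f_1(\alpha),\dots,f_n(\alpha))=0$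 for which there is no $Q\in\overline{k}[z][X_0,\dots,X_n]$, homogeneous in $X_0,\dots,X_n$, with $Q(z,1,f_1(z),\dots,f_n(z))=0$ and $Q(\alpha,X_0,\dots,X_n)=P$. -/

import Mathlib

open scoped Topology

noncomputable section

/-! ## The completed algebraic closure of a valued field -/

section Fields

variable (k C : Type*) [NontriviallyNormedField k] [NontriviallyNormedField C] [NormedAlgebra k C]

/-- The closure of (the image of) `k` in `C`; when `C` is complete this is the completion of `k`. -/
def closureIn : Subfield C := (algebraMap k C).fieldRange.topologicalClosure

/-- `C` is the completion of an algebraic closure of the completion of the valued field `k`: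
`C` is complete (so that the closure `k_c` of `k` in `C` is the completion of `k`), the elements of
`C` that are algebraic over `k_c` form an algebraically closed field, and they are dense in `C`.
That `C` extends the absolute value of `k` is part of `NormedAlgebra k C`. -/
structure IsCompletedAlgClosure : Prop where
  complete : CompleteSpace C
  isAlgClosed : IsAlgClosed (algebraicClosure (closureIn k C) C)
  dense : Dense (algebraicClosure (closureIn k C) C : Set C)

end Fields

/-! ## Domains and analytic functions -/

section Analytic

variable {C : Type*} [NontriviallyNormedField C]

/-- A holed disc: a closed disc minus finitely many open discs, all the radii being positive and in
the value group. Over an algebraically closed complete ultrametric field these are exactly the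
connected affinoid subsets of the affine line. -/
def IsHoledDisc (D : Set C) : Prop :=
  ∃ (a ρ : C) (m : ℕ) (c s : Fin m → C), ρ ≠ 0 ∧ (∀ j, s j ≠ 0) ∧
    D = Metric.closedBall a ‖ρ‖ \ ⋃ j, Metric.ball (c j) ‖s j‖

/-- `f` is, on `D`, a uniform limit of rational functions without poles in `D`. -/
def IsUniformLimitOfRational (f : C → C) (D : Set C) : Prop :=
  ∀ ε : ℝ, 0 < ε → ∃ P Q : Polynomial C, (∀ z ∈ D, Q.eval z ≠ 0) ∧
    ∀ z ∈ D, ‖f z - P.eval z / Q.eval z‖ < ε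

/-- Domains. For an archimedean absolute value: connected open sets. For an ultrametric one, where
no nonempty open set is connected: nonempty sets any two points of which lie in a common
holed disc contained in the set (these sets are open). -/
def IsAnalyticDomain (U : Set C) : Prop :=
  (¬ IsUltrametricDist C ∧ IsOpen U ∧ IsConnected U) ∨
  (IsUltrametricDist C ∧ U.Nonempty ∧
    ∀ x ∈ U, ∀ y ∈ U, ∃ D : Set C, IsHoledDisc D ∧ D ⊆ U ∧ x ∈ D ∧ y ∈ D)

/-- Analytic functions on a domain. For an archimedean absolute value: functions with a convergent
power series expansion around each point. For an ultrametric one: functions which are, on each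
holed disc contained in `U`, uniform limits of rational functions without poles there. -/
def IsAnalyticOnDomain (f : C → C) (U : Set C) : Prop :=
  (¬ IsUltrametricDist C ∧ AnalyticOnNhd C f U) ∨
  (IsUltrametricDist C ∧ ∀ D : Set C, IsHoledDisc D → D ⊆ U → IsUniformLimitOfRational f D)

/-- The power series `F`, with coefficients in a field `K` contained in `C`, converges to `f` in a
neighbourhood of the origin. -/
def IsExpansionAtZero {K : Type*} [Field K] [Algebra K C] (F : PowerSeries K) (f : C → C) : Prop :=
  ∀ᶠ z in 𝓝 (0 : C), HasSum (fun m : ℕ => algebraMap K C (PowerSeries.coeff m F) * z ^ m) (f z)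

end Analytic

/-! ## Regular extensions -/

/-- A field extension `E / K` is regular if it is separable (there is a transcendence basis `s` such
that `E` is separable algebraic over `K(s)`) and every element of `E` that is algebraic over `K`
belongs to `K`. -/
def IsRegularExtension (K E : Type*) [Field K] [Field E] [Algebra K E] : Prop :=
  (∃ s : Set E, IsTranscendenceBasis K (Subtype.val : s → E) ∧
    Algebra.IsSeparable (IntermediateField.adjoin K s) E) ∧
  ∀ x : E, IsAlgebraic K x → x ∈ Set.range (algebraMap K E)

/-- The finitely generated extension `K(u_1, …, u_n) / K`, inside a field `L`, is regular. -/
def IsRegularAdjoin (K : Type*) {L : Type*} [Field K] [Field L] [Algebra K L] {n : ℕ}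
    (u : Fin n → L) : Prop :=
  IsRegularExtension K (IntermediateField.adjoin K (Set.range u))

section Ideals

open scoped RatFunc

variable {K : Type*} [Field K]

/-- The extension `K(z)(F_1, …, F_n) / K(z)`, inside the field of Laurent series, is regular. -/
def IsRegularFunctionField {n : ℕ} (F : Fin n → PowerSeries K) : Prop :=
  IsRegularAdjoin (RatFunc K) fun i => (F i : LaurentSeries K)

/-! ## Ideals of relations -/

/-- The ideal `𝔭` of the polynomials `Q ∈ K(z)[X_1, …, X_n]` with `Q(z, F_1(z), …, F_n(z)) = 0`. -/
def functionRelations {n : ℕ} (F : Fin n → PowerSeries K) :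
    Ideal (MvPolynomial (Fin n) (RatFunc K)) :=
  RingHom.ker (MvPolynomial.aeval (R := RatFunc K) fun i => (F i : LaurentSeries K))

/-- The ideal of the polynomials `P ∈ K[X_1, …, X_n]` with `P(v_1, …, v_n) = 0`. -/
def valueRelations (K : Type*) [Field K] {C : Type*} [Field C] [Algebra K C] {n : ℕ}
    (v : Fin n → C) : Ideal (MvPolynomial (Fin n) K) :=
  RingHom.ker (MvPolynomial.aeval (R := K) v)

/-- The homogenized ideal of an ideal `𝔮` of `R[X_1, …, X_n]`: the ideal of `R[X_0, …, X_n]`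
generated by the homogeneous polynomials `Q` such that `Q(1, X_1, …, X_n) ∈ 𝔮`. -/
def homogenizedIdeal {R : Type*} [CommRing R] {n : ℕ} (q : Ideal (MvPolynomial (Fin n) R)) :
    Ideal (MvPolynomial (Fin (n + 1)) R) :=
  Ideal.span {Q | (∃ d : ℕ, Q.IsHomogeneous d) ∧
    MvPolynomial.aeval (Fin.cons 1 MvPolynomial.X : Fin (n + 1) → MvPolynomial (Fin n) R) Q ∈ q}

/-- The evaluation at `z = α` of polynomials in `K[z][X]`. -/
def evAt {m : ℕ} (α : K) : MvPolynomial (Fin m) (Polynomial K) →+* MvPolynomial (Fin m) K :=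
  MvPolynomial.map (Polynomial.evalRingHom α)

/-- The inclusion of `K[z][X]` in `K(z)[X]`. -/
def toRatFunc {m : ℕ} :
    MvPolynomial (Fin m) (Polynomial K) →+* MvPolynomial (Fin m) (RatFunc K) :=
  MvPolynomial.map (algebraMap (Polynomial K) (RatFunc K))

/-- `ev_α(I ∩ K[z][X])` for an ideal `I` of `K(z)[X]`. -/
def evIdeal {m : ℕ} (α : K) (I : Ideal (MvPolynomial (Fin m) (RatFunc K))) :
    Ideal (MvPolynomial (Fin m) K) :=
  (I.comap toRatFunc).map (evAt α)

/-- Every homogeneous relation `P` over `K` between the numbers `v_i` is the specialization at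
`z = α` of a homogeneous relation `Q` over `K[z]` between the power series `F_i`. -/
def HomogeneousRelationsLift {C : Type*} [Field C] [Algebra K C] {m : ℕ}
    (F : Fin m → PowerSeries K) (v : Fin m → C) (α : K) : Prop :=
  ∀ P : MvPolynomial (Fin m) K, (∃ d : ℕ, P.IsHomogeneous d) → MvPolynomial.aeval v P = 0 →
    ∃ Q : MvPolynomial (Fin m) (Polynomial K), (∃ d : ℕ, Q.IsHomogeneous d) ∧
      MvPolynomial.aeval (fun i => (F i : LaurentSeries K)) (toRatFunc Q) = 0 ∧ evAt α Q = P

end Ideals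

end

/-! Write `K` for the algebraic closure of `k` in `C`; it is algebraically closed. Two facts are
combined: relations between the functions always specialize to relations between their values, and
if conversely all homogeneous relations lift, the function field is regular. The first gives the
inclusion, the second its strictness.

Specialization is an identity theorem: `q(z, f(z))` vanishes near `0`, hence on all of `U`. The
archimedean case is classical. In the ultrametric case (`IsUniformLimitOfRational.eq_zero`) one
follows the absolute values of rational approximants at generic points of discs of varying radius; a
three circles inequality propagates vanishing from one radius to another.

Now suppose that the relations lift. Separability is automatic: `K` is perfect, and MacLane's
criterion holds for Laurent series because `1, z, …, z ^ (p - 1)` remain independent over `p`-th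
powers (`LaurentSeries.linearIndependent_pow`). Let `x` in the function field be algebraic over
`K(z)`, put `L = K(z)(x)` and choose a place of `L` above `α` with residue field `K`
(`exists_place`). Compare the dimensions of the spaces of values of forms of degree `d`: over `K` at
the point, over `K(z)` and over `L` at the functions. Lifting and specialization make the first two
equal. If the relations over the valuation ring also specialize to relations of the values, the
dimension over `L` is at least as large, so independence over `K(z)` persists over `L`; writing `x`
as a quotient of two forms then forces `x ∈ K(z)`. Otherwise some relation over the valuation ring
specializes to a form not vanishing at the point. Its multiples are extra relations over `L` in
every degree; as `[L : K(z)]` is finite, the dimension would grow exponentially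
(`not_le_pow_of_growth`), whereas it is at most polynomial in `d`. -/

noncomputable section

/-! ### Dimensions of spaces of values of forms -/

section FormSpaces

open MvPolynomial Module

variable {σ : Type*}

/-- The values at `v` of the homogeneous polynomials of degree `d` over `k`. -/
def formSpace (k : Type*) [Field k] {A : Type*} [CommRing A] [Algebra k A] (v : σ → A) (d : ℕ) :
    Submodule k A :=
  (homogeneousSubmodule σ k d).map (aeval v).toLinearMap

/-- The homogeneous polynomials of degree `d` over `k` vanishing at `v`. -/
def formRelations (k : Type*) [Field k] {A : Type*} [CommRing A] [Algebra k A] (v : σ → A)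
    (d : ℕ) : Submodule k (MvPolynomial σ k) :=
  homogeneousSubmodule σ k d ⊓ LinearMap.ker (aeval v : MvPolynomial σ k →ₐ[k] A).toLinearMap

section Basic

variable {k : Type*} [Field k] {A : Type*} [CommRing A] [Algebra k A] {v : σ → A} {d e : ℕ}

theorem mem_formSpace {x : A} :
    x ∈ formSpace k v d ↔ ∃ p : MvPolynomial σ k, p.IsHomogeneous d ∧ aeval v p = x := by
  simp [formSpace, Submodule.mem_map]

theorem mem_formRelations {p : MvPolynomial σ k} :
    p ∈ formRelations k v d ↔ p.IsHomogeneous d ∧ aeval v p = 0 := by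
  simp [formRelations]

theorem mul_mem_formSpace {x y : A} (hx : x ∈ formSpace k v d) (hy : y ∈ formSpace k v e) :
    x * y ∈ formSpace k v (d + e) := by
  obtain ⟨p, hp, rfl⟩ := mem_formSpace.1 hx
  obtain ⟨q, hq, rfl⟩ := mem_formSpace.1 hy
  exact mem_formSpace.2 ⟨p * q, hp.mul hq, by simp⟩

theorem self_mem_formSpace (i : σ) : v i ∈ formSpace k v 1 :=
  mem_formSpace.2 ⟨X i, isHomogeneous_X _ _, by simp⟩

theorem one_mem_formSpace_zero : (1 : A) ∈ formSpace k v 0 :=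
  mem_formSpace.2 ⟨1, isHomogeneous_one _ _, by simp⟩

theorem formSpace_mono {i : σ} (hi : v i = 1) (hde : d ≤ e) :
    formSpace k v d ≤ formSpace k v e := by
  induction e, hde using Nat.le_induction with
  | base => exact le_rfl
  | succ e _ ih =>
    intro x hx
    simpa [hi] using mul_mem_formSpace (ih hx) (self_mem_formSpace (k := k) (v := v) i)

variable [Finite σ]

instance : FiniteDimensional k (homogeneousSubmodule σ k d) :=
  Module.Finite.iff_fg.2 (homogeneousSubmodule_fg σ k d)

instance : FiniteDimensional k (formSpace k v d) := by
  unfold formSpace; infer_instance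

instance : FiniteDimensional k (formRelations k v d) :=
  Submodule.finiteDimensional_of_le (inf_le_left : _ ≤ homogeneousSubmodule σ k d)

omit [Finite σ] in
theorem degree_eq_toFun_injective :
    Function.Injective (fun (s : {s : σ →₀ ℕ | s.degree = d}) (i : σ) =>
      (⟨s.1 i, Nat.lt_succ_of_le ((Finsupp.le_degree i s.1).trans_eq s.2)⟩ : Fin (d + 1))) := by
  intro s t hst
  ext i
  simpa using congrFun hst i

theorem finrank_homogeneousSubmodule :
    finrank k (homogeneousSubmodule σ k d) = Nat.card {s : σ →₀ ℕ | s.degree = d} := by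
  have := Fintype.ofFinite σ
  have := Finite.of_injective _ (degree_eq_toFun_injective (σ := σ) (d := d))
  have := Fintype.ofFinite {s : σ →₀ ℕ | s.degree = d}
  rw [homogeneousSubmodule_eq_finsupp_supported,
    (AddMonoidAlgebra.supportedEquivFinsupp (R := k) _).finrank_eq]
  simp [Nat.card_eq_fintype_card]

theorem finrank_map_add_finrank_ker {V V' : Type*} [AddCommGroup V] [Module k V] [AddCommGroup V']
    [Module k V'] (f : V →ₗ[k] V') (W : Submodule k V) [FiniteDimensional k W] :
    finrank k (W.map f) + finrank k (W ⊓ LinearMap.ker f : Submodule k V) = finrank k W := by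
  have h := LinearMap.finrank_range_add_finrank_ker (f.domRestrict W)
  rw [LinearMap.range_domRestrict] at h
  rw [← h]
  congr 1
  rw [LinearMap.ker_domRestrict, ← Submodule.finrank_map_subtype_eq, Submodule.map_comap_subtype]

theorem finrank_formSpace_add_finrank_formRelations :
    finrank k (formSpace k v d) + finrank k (formRelations k v d) =
      Nat.card {s : σ →₀ ℕ | s.degree = d} := by
  rw [← finrank_homogeneousSubmodule (k := k)]
  exact finrank_map_add_finrank_ker _ _

theorem card_degree_eq_le : Nat.card {s : σ →₀ ℕ | s.degree = d} ≤ (d + 1) ^ Nat.card σ := by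
  have := Fintype.ofFinite σ
  exact (Nat.card_le_card_of_injective _ (degree_eq_toFun_injective (σ := σ) (d := d))).trans_eq
    (by rw [Nat.card_fun, Nat.card_fin])

/-- A crude bound, counting monomials by their exponents; only its polynomial growth in `d` is used.
-/
theorem finrank_formSpace_le : finrank k (formSpace k v d) ≤ (d + 1) ^ Nat.card σ :=
  le_trans (by rw [← finrank_formSpace_add_finrank_formRelations (k := k) (v := v)]; omega)
    (card_degree_eq_le (σ := σ) (d := d))

end Basic

end FormSpaces

/-! ### Specialization of forms and of their relations -/

section Specialization

open MvPolynomial Module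

/-- A ring homomorphism `π` from a subring `B` of a field `L` such that every nonzero finite family
of elements of `L` is proportional to a family in `B` that `π` does not annihilate. -/
structure IsPrimitiveSpecialization {K B : Type*} (L : Type*) [Field K] [CommRing B] [Field L]
    [Algebra B L] (π : B →+* K) : Prop where
  injective : Function.Injective (algebraMap B L)
  exists_primitive : ∀ {r : ℕ} (c : Fin r → L), c ≠ 0 → ∃ (l : L) (b : Fin r → B),
    (∀ i, algebraMap B L (b i) = l * c i) ∧ ∃ i, π (b i) ≠ 0

variable {σ K B L : Type*} [Field K] [CommRing B] [Field L] [Algebra B L] {π : B →+* K}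

theorem aeval_map_sum_C_mul {R S A ι : Type*} [CommRing R] [CommRing S] [CommRing A] [Algebra S A]
    (f : R →+* S) (x : σ → A) (t : Finset ι) (b : ι → R) (p : ι → MvPolynomial σ R) :
    aeval x (map f (∑ i ∈ t, C (b i) * p i)) = ∑ i ∈ t, f (b i) • aeval x (map f (p i)) := by
  simp only [map_sum, map_mul, map_C, aeval_C, Algebra.smul_def]

/-- A dependence over `L`, scaled to be primitive, has coefficients in `B` and reduces to a
nontrivial dependence over `K`. -/
theorem IsPrimitiveSpecialization.linearIndependent_map (h : IsPrimitiveSpecialization L π) {r : ℕ}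
    {p : Fin r → MvPolynomial σ B} (hp : LinearIndependent K fun i => map π (p i)) :
    LinearIndependent L fun i => map (algebraMap B L) (p i) := by
  rw [Fintype.linearIndependent_iff] at hp ⊢
  intro c hc
  by_contra! hne
  obtain ⟨l, b, hb, i, hi⟩ := h.exists_primitive c (by rintro rfl; simp at hne)
  refine hi (hp (fun i => π (b i)) ?_ i)
  have : ∑ i, C (b i) * p i = 0 := by
    apply map_injective _ h.injective
    have := congrArg (l • ·) hc
    simpa [Finset.smul_sum, hb, smul_eq_C_mul, mul_assoc] using this
  simpa [smul_eq_C_mul] using congrArg (map π) this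

variable {Λ E : Type*} [Field Λ] [Algebra L Λ] [Field E] [Algebra K E] {G : σ → Λ} {v : σ → E}

theorem IsPrimitiveSpecialization.finrank_le_of_lift [Finite σ] (h : IsPrimitiveSpecialization L π)
    {d : ℕ} {W : Submodule K (MvPolynomial σ K)} [FiniteDimensional K W]
    (hW : ∀ w ∈ W, ∃ q : MvPolynomial σ B, q.IsHomogeneous d ∧ map π q = w ∧
      aeval G (map (algebraMap B L) q) = 0) :
    finrank K W ≤ finrank L (formRelations L G d) := by
  choose! q hqh hqw hq using hW
  let b := finBasis K W
  have hli : LinearIndependent K fun i => map π (q (b i)) := by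
    simp_rw [fun i => hqw _ (b i).2]
    exact b.linearIndependent.map' W.subtype W.ker_subtype
  have hli := h.linearIndependent_map hli
  have : LinearIndependent L fun i => (⟨map (algebraMap B L) (q (b i)), mem_formRelations.2
      ⟨(hqh _ (b i).2).map _, hq _ (b i).2⟩⟩ : formRelations L G d) :=
    LinearIndependent.of_comp (formRelations L G d).subtype hli
  simpa using this.fintype_card_le_finrank

/-- Same scaling argument, for values instead of forms; `hred` is what allows the dependence to be
reduced. -/
theorem IsPrimitiveSpecialization.linearIndependent_aeval
    (h : IsPrimitiveSpecialization L π) {d r : ℕ}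
    (hred : ∀ q : MvPolynomial σ B, q.IsHomogeneous d → aeval G (map (algebraMap B L) q) = 0 →
      aeval v (map π q) = 0) {p : Fin r → MvPolynomial σ B} (hp : ∀ i, (p i).IsHomogeneous d)
    (hli : LinearIndependent K fun i => aeval v (map π (p i))) :
    LinearIndependent L fun i => aeval G (map (algebraMap B L) (p i)) := by
  rw [Fintype.linearIndependent_iff] at hli ⊢
  intro c hc
  by_contra! hne
  obtain ⟨l, b, hb, i, hi⟩ := h.exists_primitive c (by rintro rfl; simp at hne)
  refine hi (hli (fun i => π (b i)) ?_ i)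
  rw [← aeval_map_sum_C_mul]
  refine hred _ (IsHomogeneous.sum _ _ _ fun i _ => ?_) ?_
  · simpa only [zero_add] using (isHomogeneous_C σ (b i)).mul (hp i)
  · rw [aeval_map_sum_C_mul, ← smul_zero l, ← hc, Finset.smul_sum]
    exact Finset.sum_congr rfl fun i _ => by rw [hb, smul_smul]

theorem card_le_finrank_formSpace [Finite σ] {d r : ℕ} {p : Fin r → MvPolynomial σ L}
    (hp : ∀ i, (p i).IsHomogeneous d) (hli : LinearIndependent L fun i => aeval G (p i)) :
    r ≤ finrank L (formSpace L G d) := by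
  have : LinearIndependent L fun i =>
      (⟨aeval G (p i), mem_formSpace.2 ⟨p i, hp i, rfl⟩⟩ : formSpace L G d) :=
    LinearIndependent.of_comp (formSpace L G d).subtype hli
  simpa using this.fintype_card_le_finrank

theorem IsPrimitiveSpecialization.finrank_formSpace_le [Finite σ]
    (h : IsPrimitiveSpecialization L π) {ι : K →+* B} (hι : π.comp ι = RingHom.id K) {d : ℕ}
    (hred : ∀ q : MvPolynomial σ B, q.IsHomogeneous d → aeval G (map (algebraMap B L) q) = 0 →
      aeval v (map π q) = 0) :
    finrank K (formSpace K v d) ≤ finrank L (formSpace L G d) := by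
  let b := finBasis K (formSpace K v d)
  choose p hph hp using fun i => mem_formSpace.1 (b i).2
  have hmap : ∀ i, map π (map ι (p i)) = p i := fun i => by
    rw [MvPolynomial.map_map, hι, MvPolynomial.map_id]
  refine card_le_finrank_formSpace (fun i => ((hph i).map ι).map (algebraMap B L))
    (h.linearIndependent_aeval (π := π) (v := v) hred (fun i => (hph i).map ι) ?_)
  simp_rw [hmap, hp]
  exact b.linearIndependent.map' _ (Submodule.ker_subtype _)

/-- If a relation `q` over `B` specializes to a form that does not vanish at `v`, and the
relations of `v` all lift, then the forms in `G` span a smaller space than those in `v`. -/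
theorem IsPrimitiveSpecialization.finrank_formSpace_add_le [Finite σ]
    (h : IsPrimitiveSpecialization L π) {ι : K →+* B} (hι : π.comp ι = RingHom.id K) {d e : ℕ}
    (hlift : ∀ p ∈ formRelations K v (d + e), ∃ q : MvPolynomial σ B, q.IsHomogeneous (d + e) ∧
      map π q = p ∧ aeval G (map (algebraMap B L) q) = 0)
    {q : MvPolynomial σ B} (hq : q.IsHomogeneous e) (hqG : aeval G (map (algebraMap B L) q) = 0)
    (hqv : aeval v (map π q) ≠ 0) :
    finrank L (formSpace L G (d + e)) + finrank K (formSpace K v d) ≤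
      finrank K (formSpace K v (d + e)) := by
  -- `W` consists of the relations of `v` and the multiples of the specialized `q`, all of which
  -- lift to relations of `G`. As the specialized `q` is nonzero at `v`, the dimension of `W`
  -- exceeds that of the relations of `v` by exactly `finrank K (formSpace K v d)`.
  set W := formRelations K v (d + e) ⊔
    (homogeneousSubmodule σ K d).map (LinearMap.mulLeft K (map π q)) with hW
  have hrel : W ⊓ LinearMap.ker (aeval v : MvPolynomial σ K →ₐ[K] E).toLinearMap =
      formRelations K v (d + e) := by
    apply le_antisymm
    · refine le_inf (inf_le_left.trans (sup_le inf_le_left ?_)) inf_le_right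
      rintro _ ⟨p, hp, rfl⟩
      rw [add_comm]
      exact (hq.map π).mul hp
    · exact le_inf le_sup_left inf_le_right
  have himage : W.map (aeval v : MvPolynomial σ K →ₐ[K] E).toLinearMap =
      (formSpace K v d).map (LinearMap.mulLeft K (aeval v (map π q))) := by
    rw [hW, Submodule.map_sup, formSpace, ← Submodule.map_comp, ← Submodule.map_comp]
    rw [sup_eq_right.2]
    · congr 1
      ext; simp
    · rw [Submodule.map_le_iff_le_comap]
      intro p hp
      simp [(mem_formRelations.1 hp).2]
  have h1 := finrank_map_add_finrank_ker (k := K) (aeval v : MvPolynomial σ K →ₐ[K] E).toLinearMap W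
  have h2 : finrank K ((formSpace K v d).map (LinearMap.mulLeft K (aeval v (map π q)))) =
      finrank K (formSpace K v d) :=
    by
    have := finrank_map_add_finrank_ker (k := K) (LinearMap.mulLeft K (aeval v (map π q)))
      (formSpace K v d)
    rwa [LinearMap.ker_eq_bot.2 (fun x y => (mul_right_injective₀ hqv ·)), inf_bot_eq,
      finrank_bot, add_zero] at this
  have h3 : finrank K W ≤ finrank L (formRelations L G (d + e)) := by
    refine h.finrank_le_of_lift fun w hw => ?_
    obtain ⟨p, hp, _, ⟨s, hs, rfl⟩, rfl⟩ := Submodule.mem_sup.1 hw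
    obtain ⟨P, hP, hPp, hPG⟩ := hlift p hp
    refine ⟨P + q * map ι s, hP.add (by rw [add_comm]; exact hq.mul (hs.map ι)), ?_, ?_⟩
    · simp [hPp, MvPolynomial.map_map, hι, map_id]
    · simp [hPG, hqG]
  have h4 := finrank_formSpace_add_finrank_formRelations (k := K) (v := v) (d := d + e)
  have h5 := finrank_formSpace_add_finrank_formRelations (k := L) (v := G) (d := d + e)
  rw [himage, hrel, h2] at h1
  omega

end Specialization

/-- A function on `ℕ` satisfying this recursion grows exponentially. -/
theorem not_le_pow_of_growth {A : ℕ → ℕ} {s e m : ℕ} (hs : 0 < s) (h0 : 1 ≤ A 0)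
    (h : ∀ d, A (d + e) + s * A d ≤ s * A (d + e)) : ¬ ∀ d, A d ≤ (d + 1) ^ m := by
  intro hA
  obtain ⟨s, rfl⟩ | rfl : (∃ t, s = t + 2) ∨ s = 1 := by
    rcases s with _ | _ | s
    · simp at hs
    · simp
    · exact Or.inl ⟨s, rfl⟩
  swap
  · have := h 0
    omega
  -- With `s + 2` in place of `s`, the recursion reads `(s + 2) * A d ≤ (s + 1) * A (d + e)`: a
  -- growth factor greater than `1`.
  have step : ∀ j : ℕ, ((s + 2 : ℝ) / (s + 1)) ^ j ≤ A (j * e) := by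
    intro j
    induction j with
    | zero => simpa using h0
    | succ j ih =>
      have h1 : (s + 2) * A (j * e) ≤ (s + 1) * A ((j + 1) * e) := by
        have := h (j * e)
        rw [show j * e + e = (j + 1) * e by ring] at this
        nlinarith
      have h2 : ((s : ℝ) + 2) * A (j * e) ≤ (s + 1) * A ((j + 1) * e) := by exact_mod_cast h1
      rw [pow_succ, mul_div_assoc', div_le_iff₀ (by positivity)]
      nlinarith
  have hr : (1 : ℝ) < (s + 2) / (s + 1) := by
    rw [one_lt_div (by positivity)]; linarith
  have hlim := tendsto_pow_const_div_const_pow_of_one_lt m hr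
  have hlim' := hlim.const_mul (((e : ℝ) + 1) ^ m)
  rw [mul_zero] at hlim'
  obtain ⟨j, hj, hj1⟩ := ((hlim'.eventually (gt_mem_nhds one_pos)).and
    (Filter.eventually_ge_atTop 1)).exists
  have hb : (A (j * e) : ℝ) ≤ (((e : ℝ) + 1) * j) ^ m := by
    refine le_trans (b := (((j * e : ℕ) : ℝ) + 1) ^ m) (by exact_mod_cast hA (j * e))
      (pow_le_pow_left₀ (by positivity) ?_ m)
    have : (1 : ℝ) ≤ j := by exact_mod_cast hj1
    push_cast
    nlinarith
  rw [mul_div_assoc', ← mul_pow, div_lt_one (pow_pos (by positivity) _)] at hj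
  exact absurd (step j) (not_le.2 (hb.trans_lt hj))

/-! ### Comparing dimensions over a field and a finite extension -/

section Comparison

open MvPolynomial Module

variable {σ K B₁ K₁ B L Λ E : Type*} [Field K] [CommRing B₁] [Field K₁] [Algebra B₁ K₁]
  [CommRing B] [Field L] [Algebra B L] [Algebra K₁ L] [Field Λ] [Algebra L Λ] [Algebra K₁ Λ]
  [IsScalarTower K₁ L Λ] [Field E] [Algebra K E] {G : σ → Λ} {v : σ → E}

theorem formSpace_le_restrictScalars (d : ℕ) :
    formSpace K₁ G d ≤ (formSpace L G d).restrictScalars K₁ := by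
  intro x hx
  obtain ⟨p, hp, rfl⟩ := mem_formSpace.1 hx
  exact mem_formSpace.2 ⟨map (algebraMap K₁ L) p, hp.map _, aeval_map_algebraMap L G p⟩

theorem finrank_formSpace_le_mul [Finite σ] [FiniteDimensional K₁ L] (d : ℕ) :
    finrank K₁ (formSpace K₁ G d) ≤ finrank K₁ L * finrank L (formSpace L G d) := by
  rw [finrank_mul_finrank]
  have : FiniteDimensional K₁ ((formSpace L G d).restrictScalars K₁) :=
    Module.Finite.trans (R := K₁) L (formSpace L G d)
  exact Submodule.finrank_mono (formSpace_le_restrictScalars (L := L) d)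

/-- If all the relations of `v` lift to relations over `B₁ ⊆ B`, and the relations over `B₁`
specialize to relations of `v`, then linearly independent forms in `G` over `K₁` remain so
over `L`. -/
theorem finrank_formSpace_le_of_lift [Finite σ] [FiniteDimensional K₁ L] {π₁ : B₁ →+* K}
    (h₁ : IsPrimitiveSpecialization K₁ π₁) {ι₁ : K →+* B₁} (hι₁ : π₁.comp ι₁ = RingHom.id K)
    {π : B →+* K} (h : IsPrimitiveSpecialization L π) {φ : B₁ →+* B} (hφπ : π.comp φ = π₁)
    (hφ : (algebraMap B L).comp φ = (algebraMap K₁ L).comp (algebraMap B₁ K₁))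
    (hspec : ∀ (d : ℕ) (q : MvPolynomial σ B₁), q.IsHomogeneous d →
      aeval G (map (algebraMap B₁ K₁) q) = 0 → aeval v (map π₁ q) = 0)
    (hlift : ∀ d, ∀ p ∈ formRelations K v d, ∃ q : MvPolynomial σ B₁, q.IsHomogeneous d ∧
      map π₁ q = p ∧ aeval G (map (algebraMap B₁ K₁) q) = 0) (d : ℕ) :
    finrank K₁ (formSpace K₁ G d) ≤ finrank L (formSpace L G d) := by
  have hι : π.comp (φ.comp ι₁) = RingHom.id K := by rw [← RingHom.comp_assoc, hφπ, hι₁]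
  have hle : ∀ d, finrank K₁ (formSpace K₁ G d) ≤ finrank K (formSpace K v d) := by
    intro d
    have := h₁.finrank_le_of_lift (hlift d)
    have h4 := finrank_formSpace_add_finrank_formRelations (k := K) (v := v) (d := d)
    have h5 := finrank_formSpace_add_finrank_formRelations (k := K₁) (v := G) (d := d)
    omega
  have hge : ∀ d, finrank K (formSpace K v d) ≤ finrank K₁ (formSpace K₁ G d) := fun d =>
    h₁.finrank_formSpace_le hι₁ (hspec d)
  by_cases hred : ∀ (e : ℕ) (q : MvPolynomial σ B), q.IsHomogeneous e →
      aeval G (map (algebraMap B L) q) = 0 → aeval v (map π q) = 0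
  · exact (hle d).trans (h.finrank_formSpace_le hι (hred d))
  -- Put `A d = finrank K (formSpace K v d)` and `s = [L : K₁]`. The offending `q` gives `A (d + e)
  -- ≤ s * finrank L (formSpace L G (d + e)) ≤ s * (A (d + e) - A d)`, which is exponential growth.
  · push Not at hred
    obtain ⟨e, q, hq, hqG, hqv⟩ := hred
    refine absurd (fun d => finrank_formSpace_le) (not_le_pow_of_growth
      (A := fun d => finrank K (formSpace K v d)) (s := finrank K₁ L) (e := e) (m := Nat.card σ)
      finrank_pos ?_ fun d => ?_)
    · have : Nontrivial (formSpace K v 0) :=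
        ⟨⟨1, one_mem_formSpace_zero⟩, 0, by simp [Subtype.ext_iff]⟩
      exact Nat.succ_le_of_lt finrank_pos
    · have := h.finrank_formSpace_add_le (G := G) (v := v) (d := d) hι (fun p hp => by
        obtain ⟨P, hP, hPp, hPG⟩ := hlift _ p hp
        refine ⟨map φ P, hP.map φ, by rw [MvPolynomial.map_map, hφπ, hPp], ?_⟩
        rw [MvPolynomial.map_map, hφ, ← MvPolynomial.map_map, aeval_map_algebraMap, hPG]) hq hqG hqv
      have h2 := finrank_formSpace_le_mul (K₁ := K₁) (L := L) (G := G) (d + e)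
      have h3 := hge (d + e)
      nlinarith

/-- A `K₁`-basis of the values of forms spans the corresponding space over `L`, so by the dimension
hypothesis it stays independent over `L`. Comparing coordinates in `g * b = a` makes `g` a quotient
of elements of `K₁`. -/
theorem mem_range_of_finrank_formSpace_le [Finite σ] {d : ℕ}
    (h : finrank K₁ (formSpace K₁ G d) ≤ finrank L (formSpace L G d)) {g : L} {a b : Λ}
    (ha : a ∈ formSpace K₁ G d) (hb : b ∈ formSpace K₁ G d) (hb0 : b ≠ 0)
    (hab : algebraMap L Λ g * b = a) : g ∈ Set.range (algebraMap K₁ L) := by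
  let β := finBasis K₁ (formSpace K₁ G d)
  have hspan : Submodule.span K₁ (Set.range fun i => (β i : Λ)) = formSpace K₁ G d := by
    have := congrArg (Submodule.map (formSpace K₁ G d).subtype) β.span_eq
    rw [Submodule.map_span, Submodule.map_top, Submodule.range_subtype, ← Set.range_comp] at this
    exact this
  -- The `L`-space is spanned by values of monomials, and these already lie in the `K₁`-space.
  have hspanL : formSpace L G d ≤ Submodule.span L (Set.range fun i => (β i : Λ)) := by
    intro x hx
    obtain ⟨p, hp, rfl⟩ := mem_formSpace.1 hx
    rw [aeval_def, eval₂_eq]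
    refine Submodule.sum_mem _ fun s hs => ?_
    rw [← Algebra.smul_def]
    refine Submodule.smul_mem _ _ (Submodule.span_le_restrictScalars K₁ L _ ?_)
    rw [hspan]
    refine mem_formSpace.2 ⟨monomial s 1, isHomogeneous_monomial _ ?_, by simp [aeval_monomial,
      Finsupp.prod]⟩
    have := hp (mem_support_iff.1 hs)
    rwa [Finsupp.degree_eq_weight_one]
  have hli : LinearIndependent L fun i => (β i : Λ) := by
    rw [linearIndependent_iff_card_eq_finrank_span]
    refine le_antisymm ?_ (finrank_range_le_card _)
    have := FiniteDimensional.span_of_finite L (Set.finite_range fun i => (β i : Λ))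
    rw [Fintype.card_fin]
    exact h.trans (Submodule.finrank_mono hspanL)
  rw [← hspan, Submodule.mem_span_range_iff_exists_fun] at ha hb
  obtain ⟨x, rfl⟩ := ha
  obtain ⟨y, rfl⟩ := hb
  have key : ∀ i, g * algebraMap K₁ L (y i) - algebraMap K₁ L (x i) = 0 := by
    refine Fintype.linearIndependent_iff.1 hli _ ?_
    simp only [sub_smul, mul_smul, Finset.sum_sub_distrib, algebraMap_smul]
    rw [← Finset.smul_sum, Algebra.smul_def, hab, sub_self]
  obtain ⟨i, hi⟩ : ∃ i, y i ≠ 0 := by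
    by_contra! hy
    simp [hy] at hb0
  refine ⟨x i / y i, ?_⟩
  rw [map_div₀, div_eq_iff (by simpa using hi), ← sub_eq_zero, ← neg_sub, key, neg_zero]

end Comparison

/-! ### Rational places of algebraic function fields -/

section Places

open Polynomial

variable {K : Type*} [Field K]

/-- Denominators can be cleared so that not every entry falls in the prime ideal of `K[X]` at `α`.
-/
theorem isPrimitiveSpecialization_evalRingHom (α : K) :
    IsPrimitiveSpecialization (RatFunc K) (evalRingHom α) := by
  refine ⟨IsFractionRing.injective _ _, fun c hc => ?_⟩
  obtain ⟨j, hj⟩ := Function.ne_iff.1 hc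
  obtain ⟨a, ha, i, -, hi⟩ := Ideal.exist_integer_multiples_notMem (A := K[X]) (K := RatFunc K)
    (RingHom.ker_ne_top (evalRingHom α)) Finset.univ c (Finset.mem_univ j) hj
  choose b hb using fun i => ha i (Finset.mem_univ i)
  refine ⟨a, b, hb, i, fun h => hi ?_⟩
  rw [FractionalIdeal.mem_coeIdeal]
  exact ⟨b i, h, hb i⟩

/-- Dividing by an entry of maximal valuation brings the family into `O` and turns that entry into
`1`. -/
theorem ValuationSubring.isPrimitiveSpecialization {L : Type*} [Field L] (O : ValuationSubring L)
    (π : O →+* K) : IsPrimitiveSpecialization L π := by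
  refine ⟨Subtype.val_injective, fun {r} c hc => ?_⟩
  obtain ⟨j, hj⟩ := Function.ne_iff.1 hc
  obtain ⟨i, -, hi⟩ := Finset.exists_max_image Finset.univ (fun i => O.valuation (c i))
    ⟨j, Finset.mem_univ j⟩
  have hci : c i ≠ 0 := by
    intro h
    have := hi j (Finset.mem_univ j)
    simp [h] at this
    exact hj this
  have hmem : ∀ k, (c i)⁻¹ * c k ∈ O := by
    intro k
    rw [← O.valuation_le_one_iff, map_mul, map_inv₀, mul_comm, ← div_eq_mul_inv]
    exact div_le_one_of_le₀ (hi k (Finset.mem_univ k)) zero_le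
  refine ⟨(c i)⁻¹, fun k => ⟨_, hmem k⟩, fun k => rfl, i, ?_⟩
  have : (⟨_, hmem i⟩ : O) = 1 := Subtype.ext (inv_mul_cancel₀ hci)
  change π ⟨_, hmem i⟩ ≠ 0
  rw [this, map_one]
  exact one_ne_zero

/-- An algebraic function field over an algebraically closed field `K` has a `K`-rational place
above every point of the affine line. -/
theorem exists_place [IsAlgClosed K] {L : Type*} [Field L] [Algebra (RatFunc K) L]
    [Algebra.IsAlgebraic (RatFunc K) L] (α : K) :
    ∃ (O : ValuationSubring L) (π : O →+* K) (φ : K[X] →+* O), π.comp φ = evalRingHom α ∧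
      (algebraMap O L).comp φ =
        (algebraMap (RatFunc K) L).comp (algebraMap K[X] (RatFunc K)) := by
  set P : Ideal K[X] := RingHom.ker (evalRingHom α) with hP
  have : P.IsPrime := RingHom.ker_isPrime _
  set f : K[X] →+* L := (algebraMap (RatFunc K) L).comp (algebraMap K[X] (RatFunc K)) with hf
  have hfinj : Function.Injective f :=
    (algebraMap (RatFunc K) L).injective.comp (IsFractionRing.injective _ _)
  have hunit : ∀ y : P.primeCompl, IsUnit (f y) := fun y => by
    refine isUnit_iff_ne_zero.2 fun h => y.2 ?_
    rw [(map_eq_zero_iff f hfinj).1 h]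
    exact zero_mem P
  -- A valuation ring of `L` dominating the local ring of the affine line at `α`.
  obtain ⟨O, hO, hloc⟩ := IsLocalRing.exists_factor_valuationRing
    (IsLocalization.lift (M := P.primeCompl) (S := Localization.AtPrime P) hunit)
  set ψ := (IsLocalization.lift (M := P.primeCompl) (S := Localization.AtPrime P)
    hunit).codRestrict O.toSubring hO with hψ
  set φ : K[X] →+* O := ψ.comp (algebraMap K[X] (Localization.AtPrime P)) with hφ
  have hφf : (algebraMap O L).comp φ = f := by
    ext x
    · exact IsLocalization.lift_eq hunit _
    · exact IsLocalization.lift_eq hunit _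
  set res : K[X] →+* IsLocalRing.ResidueField O := (IsLocalRing.residue O).comp φ with hres
  let ρ : K →+* IsLocalRing.ResidueField O := res.comp C
  have hresρ : ∀ p, res p = ρ (p.eval α) := by
    intro p
    rw [← sub_eq_zero]
    change res p - res (C (p.eval α)) = 0
    rw [← map_sub, hres, RingHom.comp_apply, IsLocalRing.residue_eq_zero_iff,
      IsLocalRing.mem_maximalIdeal, mem_nonunits_iff]
    intro h
    have h1 := hloc.map_nonunit _ h
    rw [IsLocalization.AtPrime.isUnit_to_map_iff _ P] at h1
    exact h1 (by simp [hP])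
  have hsurj : Function.Surjective ρ := by
    intro y
    obtain ⟨x, rfl⟩ := IsLocalRing.residue_surjective y
    -- The equation of `x` over `K(z)`, made primitive at `α`, reduces to a nonzero polynomial `q`
    -- over `K` that kills the residue of `x`; all roots of `q` come from `K`.
    obtain ⟨p, hp0, hp⟩ := Algebra.IsAlgebraic.isAlgebraic (R := RatFunc K) (x : L)
    obtain ⟨l, b, hb, i, hi⟩ := (isPrimitiveSpecialization_evalRingHom α).exists_primitive
      (fun i : Fin (p.natDegree + 1) => p.coeff i) (fun h => hp0 (by
        have := congrFun h (Fin.last _)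
        simpa using this))
    have hsum : ∑ i, φ (b i) * x ^ (i : ℕ) = 0 := by
      apply Subtype.val_injective
      have : (algebraMap O L) (∑ i, φ (b i) * x ^ (i : ℕ)) = 0 := by
        have hφb : ∀ i, algebraMap O L (φ (b i)) =
            algebraMap (RatFunc K) L l * algebraMap (RatFunc K) L (p.coeff i) := fun i => by
          rw [← RingHom.comp_apply, hφf, hf, RingHom.comp_apply, hb, map_mul]
        rw [aeval_eq_sum_range, ← Fin.sum_univ_eq_sum_range
          (fun i => p.coeff i • (x : L) ^ i)] at hp
        simp only [map_sum, map_mul, map_pow, hφb, mul_assoc, ← Finset.mul_sum]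
        rw [← mul_zero (algebraMap (RatFunc K) L l), ← hp]
        simp only [Algebra.smul_def]
        rfl
      exact this
    let q : K[X] := ∑ i, C ((b i).eval α) * X ^ (i : ℕ)
    have hq0 : q ≠ 0 := by
      intro h
      apply hi
      have := congrArg (fun q => coeff q i) h
      simpa [q, finsetSum_coeff, coeff_C_mul, coeff_X_pow, Fin.val_inj] using this
    have hqx : (q.map ρ).eval (IsLocalRing.residue O x) = 0 := by
      have := congrArg (IsLocalRing.residue O) hsum
      simp only [map_sum, map_mul, map_pow, map_zero] at this
      simp only [q, Polynomial.map_sum, Polynomial.map_mul, map_C, Polynomial.map_pow, map_X,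
        eval_finsetSum, eval_mul, eval_C, eval_pow, eval_X, ← hresρ]
      exact this
    obtain ⟨a, ha⟩ := ((IsAlgClosed.splits q).mem_range_of_isRoot (i := ρ) hq0 hqx)
    exact ⟨a, ha⟩
  let e := RingEquiv.ofBijective ρ ⟨ρ.injective, hsurj⟩
  refine ⟨O, (e.symm : _ →+* K).comp (IsLocalRing.residue O), φ, ?_, hφf⟩
  refine RingHom.ext fun p => ?_
  change e.symm (res p) = _
  rw [hresρ]
  exact e.symm_apply_apply _

end Places

/-! ### Separability of fields of Laurent series over `K(z)` -/

section Separability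

open Polynomial
open scoped RatFunc

variable {K : Type*} [Field K]

/-- On monomials this is division of the exponent by `p`, the coefficient being a `p`-th power since
`K` is perfect. -/
theorem Polynomial.exists_eq_sum_X_pow_mul_pow (p : ℕ) [hp : Fact p.Prime] [CharP K p]
    [PerfectRing K p] (c : K[X]) : ∃ a : Fin p → K[X], c = ∑ j : Fin p, X ^ (j : ℕ) * a j ^ p := by
  induction c using Polynomial.induction_on' with
  | add c c' hc hc' =>
    obtain ⟨a, rfl⟩ := hc
    obtain ⟨a', rfl⟩ := hc'
    exact ⟨a + a', by simp [add_pow_char, mul_add, Finset.sum_add_distrib]⟩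
  | monomial m c =>
    obtain ⟨d, rfl⟩ := (PerfectRing.bijective_frobenius (R := K) (p := p)).2 c
    let i : Fin p := ⟨m % p, Nat.mod_lt _ hp.out.pos⟩
    refine ⟨Pi.single i (C d * X ^ (m / p)), ?_⟩
    rw [Finset.sum_eq_single i (fun j _ hj => by simp [hj, hp.out.ne_zero]) (by simp)]
    rw [Pi.single_eq_same, mul_pow, ← pow_mul, mul_left_comm, ← pow_add, ← C_pow,
      C_mul_X_pow_eq_monomial]
    exact congrArg (fun e => monomial e (d ^ p)) (Nat.mod_add_div' m p).symm

/-- The nonzero terms have orders congruent to their index `j` modulo `p`, hence pairwise distinct,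
and the lowest one cannot cancel. -/
theorem LaurentSeries.eq_zero_of_sum_X_pow_mul_pow_eq_zero {p : ℕ} {w : Fin p → LaurentSeries K}
    (hw : ∑ j : Fin p, HahnSeries.single (1 : ℤ) (1 : K) ^ (j : ℕ) * w j ^ p = 0) (j : Fin p) :
    w j = 0 := by
  classical
  by_contra hj
  have hsingle : ∀ j : ℕ, (HahnSeries.single (1 : ℤ) (1 : K)) ^ j ≠ 0 := fun j =>
    pow_ne_zero _ (HahnSeries.single_ne_zero one_ne_zero)
  set u : Fin p → LaurentSeries K := fun j => HahnSeries.single (1 : ℤ) (1 : K) ^ (j : ℕ) * w j ^ p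
  have hord : ∀ j, w j ≠ 0 → (u j).order = j + p * (w j).order := by
    intro j hj
    rw [HahnSeries.order_mul (hsingle _) (pow_ne_zero _ hj), HahnSeries.order_pow,
      HahnSeries.order_pow, HahnSeries.order_single one_ne_zero]
    simp
  obtain ⟨i, hi, hmin⟩ := Finset.exists_min_image (Finset.univ.filter fun j => w j ≠ 0)
    (fun j => (u j).order) ⟨j, by simpa using hj⟩
  have hi' : w i ≠ 0 := by simpa using hi
  have hcoeff := congrArg (fun x => HahnSeries.coeff x (u i).order) hw
  rw [HahnSeries.coeff_zero] at hcoeff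
  have hui : u i ≠ 0 := mul_ne_zero (hsingle _) (pow_ne_zero _ hi')
  refine HahnSeries.coeff_order_eq_zero.not.2 hui ?_
  rw [← hcoeff, HahnSeries.coeff_sum, Finset.sum_eq_single i _ (by simp)]
  intro l _ hli
  by_cases hl : w l = 0
  · have : u l = 0 := by simp [u, hl, (Fin.pos l).ne']
    change (u l).coeff _ = 0
    rw [this, HahnSeries.coeff_zero]
  · refine HahnSeries.coeff_eq_zero_of_lt_order (lt_of_le_of_ne
      (hmin l (by simpa using hl)) fun h => hli ?_)
    rw [hord i hi', hord l hl] at h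
    have h1 := congrArg (fun x : ℤ => x % p) h
    simp only [Int.add_mul_emod_self_left] at h1
    norm_cast at h1
    rw [Nat.mod_eq_of_lt i.2, Nat.mod_eq_of_lt l.2] at h1
    exact Fin.ext h1.symm

/-- For a perfect field `K` of characteristic `p`, the `p`-th powers of Laurent series that are
linearly independent over `K(X)` are linearly independent over `K(X)`. -/
theorem LaurentSeries.linearIndependent_pow (p : ℕ) [hp : Fact p.Prime] [CharP K p]
    [PerfectRing K p] {ι : Type*} {v : ι → LaurentSeries K}
    (hv : LinearIndependent (RatFunc K) v) : LinearIndependent (RatFunc K) fun i => v i ^ p := by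
  rw [← LinearIndependent.iff_fractionRing K[X] (RatFunc K)] at hv ⊢
  have : CharP (LaurentSeries K) p :=
    charP_of_injective_algebraMap (algebraMap K (LaurentSeries K)).injective p
  rw [linearIndependent_iff'] at hv ⊢
  intro s c hc i hi
  choose a ha using fun i => Polynomial.exists_eq_sum_X_pow_mul_pow p (c i)
  have hX : algebraMap K[X] (LaurentSeries K) X = HahnSeries.single (1 : ℤ) (1 : K) := by
    rw [IsScalarTower.algebraMap_apply K[X] (RatFunc K), RatFunc.algebraMap_X, RatFunc.coe_X]
  -- Writing `c i = ∑ j, X ^ j * a i j ^ p`, the relation becomes `∑ j, X ^ j * (∑ i, a i j • v i) ^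
  -- p = 0`, by additivity of Frobenius.
  have hzero := LaurentSeries.eq_zero_of_sum_X_pow_mul_pow_eq_zero
    (w := fun j : Fin p => ∑ i ∈ s, a i j • v i) (by
      rw [← hc]
      simp only [sum_pow_char, Finset.mul_sum]
      rw [Finset.sum_comm]
      refine Finset.sum_congr rfl fun i _ => ?_
      rw [ha i, Finset.sum_smul]
      refine Finset.sum_congr rfl fun j _ => ?_
      simp only [Algebra.smul_def, map_mul, map_pow, hX, mul_pow, mul_assoc])
  rw [ha i]
  refine Finset.sum_eq_zero fun j _ => ?_
  rw [hv s (fun i => a i j) (hzero j) i hi, zero_pow hp.out.ne_zero, mul_zero]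

end Separability

/-! ### Lifting of relations implies regularity -/

section Regularity

open scoped RatFunc

/-- MacLane's criterion for a finitely generated field extension. -/
theorem exists_isTranscendenceBasis_and_isSeparable_adjoin.{a, b} {k : Type a} {Λ : Type b}
    [Field k] [Field Λ] [Algebra k Λ] {n : ℕ} (u : Fin n → Λ)
    (H : ∀ (p : ℕ) [Fact p.Prime] [CharP k p] {ι : Type b} (v : ι → Λ), LinearIndependent k v →
      LinearIndependent k fun i => v i ^ p) :
    ∃ s : Set (IntermediateField.adjoin k (Set.range u)),
      IsTranscendenceBasis k (Subtype.val : s → IntermediateField.adjoin k (Set.range u)) ∧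
      Algebra.IsSeparable (IntermediateField.adjoin k s)
        (IntermediateField.adjoin k (Set.range u)) := by
  set E := IntermediateField.adjoin k (Set.range u) with hE
  have : Algebra.EssFiniteType k E :=
    IntermediateField.essFiniteType_iff.2
      (IntermediateField.fg_adjoin_of_finite (Set.finite_range u))
  obtain hk | ⟨p, hp, hpk⟩ := CharP.exists' k
  · obtain ⟨s, hs⟩ := exists_isTranscendenceBasis_and_isSeparable_of_perfectField k E
    exact ⟨s, hs⟩
  · have : ExpChar k p := .prime hp.out
    obtain ⟨s, hs⟩ :=
      exists_isTranscendenceBasis_and_isSeparable_of_linearIndepOn_pow_of_essFiniteType p hp.out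
        (k := k) (K := E) fun s hs => by
          have h1 : LinearIndependent k fun x : (s : Set E) => ((x : E) : Λ) :=
            LinearIndependent.map' hs E.val.toLinearMap
              (LinearMap.ker_eq_bot.2 Subtype.val_injective)
          exact LinearIndependent.of_comp E.val.toLinearMap (H p _ h1)
    exact ⟨s, hs⟩

theorem isRegularAdjoin_of_forall_mem_range.{a, b} {k : Type a} {Λ : Type b} [Field k] [Field Λ]
    [Algebra k Λ] {n : ℕ} (u : Fin n → Λ)
    (H : ∀ (p : ℕ) [Fact p.Prime] [CharP k p] {ι : Type b} (v : ι → Λ), LinearIndependent k v →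
      LinearIndependent k fun i => v i ^ p)
    (halg : ∀ x ∈ IntermediateField.adjoin k (Set.range u), IsAlgebraic k x →
      x ∈ Set.range (algebraMap k Λ)) : IsRegularAdjoin k u := by
  refine ⟨exists_isTranscendenceBasis_and_isSeparable_adjoin u H, fun x hx => ?_⟩
  obtain ⟨y, hy⟩ := halg x x.2 (hx.algHom (IntermediateField.adjoin k (Set.range u)).val)
  exact ⟨y, Subtype.ext hy⟩

variable {K : Type*} [Field K]

/-- The coordinate `1` serves to homogenize. With `formSpace_mono` it presents an element of the
field generated by `u` as a quotient of values of two forms of the same degree. -/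
theorem exists_aeval_mem_formSpace {k A : Type*} [Field k] [CommRing A] [Algebra k A] {n : ℕ}
    (u : Fin n → A) (p : MvPolynomial (Fin n) k) :
    ∃ d, MvPolynomial.aeval u p ∈ formSpace k (Fin.cons 1 u : Fin (n + 1) → A) d := by
  have h1 : (Fin.cons 1 u : Fin (n + 1) → A) 0 = 1 := rfl
  induction p using MvPolynomial.induction_on with
  | C a =>
    refine ⟨0, ?_⟩
    rw [MvPolynomial.aeval_C, Algebra.algebraMap_eq_smul_one]
    exact Submodule.smul_mem _ _ one_mem_formSpace_zero
  | add p q hp hq =>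
    obtain ⟨d, hd⟩ := hp
    obtain ⟨e, he⟩ := hq
    refine ⟨max d e, ?_⟩
    rw [map_add]
    exact add_mem (formSpace_mono h1 (le_max_left d e) hd) (formSpace_mono h1 (le_max_right d e) he)
  | mul_X p i hp =>
    obtain ⟨d, hd⟩ := hp
    refine ⟨d + 1, ?_⟩
    rw [map_mul, MvPolynomial.aeval_X]
    exact mul_mem_formSpace hd
      (self_mem_formSpace (v := (Fin.cons 1 u : Fin (n + 1) → A)) i.succ)

/-- If all homogeneous relations of `v` lift to relations of `1, u₁, …, uₙ` over `K[z]`, then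
`K(z)` is algebraically closed in `K(z)(u₁, …, uₙ)`. -/
theorem mem_range_algebraMap_of_lift [IsAlgClosed K] {Λ E : Type*} [Field Λ]
    [Algebra (RatFunc K) Λ] [Field E] [Algebra K E] {n : ℕ}
    {u : Fin n → Λ} {v : Fin (n + 1) → E} (α : K)
    (hspec : ∀ q : MvPolynomial (Fin (n + 1)) (Polynomial K),
      MvPolynomial.aeval (Fin.cons 1 u : Fin (n + 1) → Λ) (toRatFunc q) = 0 →
        MvPolynomial.aeval v (evAt α q) = 0)
    (hlift : ∀ p : MvPolynomial (Fin (n + 1)) K, (∃ d : ℕ, p.IsHomogeneous d) →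
      MvPolynomial.aeval v p = 0 → ∃ q : MvPolynomial (Fin (n + 1)) (Polynomial K),
        (∃ d : ℕ, q.IsHomogeneous d) ∧
        MvPolynomial.aeval (Fin.cons 1 u : Fin (n + 1) → Λ) (toRatFunc q) = 0 ∧ evAt α q = p)
    {x : Λ} (hxu : x ∈ IntermediateField.adjoin (RatFunc K) (Set.range u))
    (hx : IsAlgebraic (RatFunc K) x) : x ∈ Set.range (algebraMap (RatFunc K) Λ) := by
  obtain ⟨r, s, hrs⟩ := (IntermediateField.mem_adjoin_range_iff _ _ _).1 hxu
  by_cases hs : MvPolynomial.aeval u s = 0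
  · exact ⟨0, by rw [map_zero, hrs, hs, div_zero]⟩
  obtain ⟨d, hd⟩ := exists_aeval_mem_formSpace u r
  obtain ⟨e, he⟩ := exists_aeval_mem_formSpace u s
  have h1 : (Fin.cons 1 u : Fin (n + 1) → Λ) 0 = 1 := rfl
  replace hd := formSpace_mono h1 (le_max_left d e) hd
  replace he := formSpace_mono h1 (le_max_right d e) he
  let L := IntermediateField.adjoin (RatFunc K) {x}
  have : FiniteDimensional (RatFunc K) L :=
    IntermediateField.adjoin.finiteDimensional hx.isIntegral
  obtain ⟨O, π, φ, hφπ, hφ⟩ := exists_place (L := L) α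
  have hle := finrank_formSpace_le_of_lift (L := L) (G := (Fin.cons 1 u : Fin (n + 1) → _)) (v := v)
    (isPrimitiveSpecialization_evalRingHom α) (ι₁ := Polynomial.C) (by ext; simp)
    (O.isPrimitiveSpecialization π) hφπ hφ (fun _ q _ hq => hspec q hq) (fun d p hp => by
      obtain ⟨hph, hp0⟩ := mem_formRelations.1 hp
      -- The lift supplied by `hlift` has an unspecified degree. It is the degree of `p` when `p ≠
      -- 0`; for `p = 0` the lift is replaced by `0`.
      by_cases hp' : p = 0
      · exact ⟨0, MvPolynomial.isHomogeneous_zero _ _ _, by simp [hp'], by simp⟩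
      obtain ⟨q, ⟨d', hq⟩, hqG, hqp⟩ := hlift p ⟨d, hph⟩ hp0
      have : d' = d := (hqp ▸ hq.map (Polynomial.evalRingHom α) : p.IsHomogeneous d').inj_right
        hph hp'
      exact ⟨q, this ▸ hq, hqp, hqG⟩) (max d e)
  obtain ⟨y, hy⟩ := mem_range_of_finrank_formSpace_le hle (g := IntermediateField.AdjoinSimple.gen
    (RatFunc K) x) hd he hs (by
      rw [IntermediateField.AdjoinSimple.algebraMap_gen, hrs, div_mul_cancel₀ _ hs])
  refine ⟨y, ?_⟩
  have := congrArg (algebraMap L Λ) hy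
  rwa [IntermediateField.AdjoinSimple.algebraMap_gen] at this

theorem coe_cons_one {n : ℕ} (F : Fin n → PowerSeries K) :
    (fun i => ((Fin.cons 1 F : Fin (n + 1) → PowerSeries K) i : LaurentSeries K)) =
      Fin.cons 1 fun i => (F i : LaurentSeries K) := by
  ext i : 1
  refine Fin.cases ?_ (fun i => ?_) i <;> simp

/-- If the relations of the `F i` and those of `v` are specializations of each other at
`α`, then the extension of `K(z)` generated by the `F i` is regular. -/
theorem isRegularFunctionField_of_lift [IsAlgClosed K] {E : Type*} [Field E] [Algebra K E] {n : ℕ}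
    (F : Fin n → PowerSeries K) (v : Fin (n + 1) → E) (α : K)
    (hspec : ∀ q : MvPolynomial (Fin (n + 1)) (Polynomial K),
      MvPolynomial.aeval
        (fun i => ((Fin.cons 1 F : Fin (n + 1) → PowerSeries K) i : LaurentSeries K))
        (toRatFunc q) = 0 → MvPolynomial.aeval v (evAt α q) = 0)
    (hlift : HomogeneousRelationsLift (Fin.cons 1 F : Fin (n + 1) → PowerSeries K) v α) :
    IsRegularFunctionField F := by
  unfold HomogeneousRelationsLift at hlift
  rw [coe_cons_one] at hspec hlift
  refine isRegularAdjoin_of_forall_mem_range _ (fun p _ _ _ v hv => ?_)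
    fun x hx hx' => mem_range_algebraMap_of_lift α hspec hlift hx hx'
  have : CharP K p := (RingHom.charP_iff (algebraMap K (RatFunc K))
    (algebraMap K (RatFunc K)).injective p).2 ‹_›
  have : ExpChar K p := .prime (Fact.out)
  exact LaurentSeries.linearIndependent_pow p hv

end Regularity

/-! ### Algebraic closedness of the completion -/

section AlgClosed

open Polynomial

/-- A complete ultrametric field with a dense algebraically closed subfield is algebraically
closed. -/
theorem isAlgClosed_of_denseRange_of_isUltrametricDist {K L : Type*} [Field K]
    [NontriviallyNormedField L] [CompleteSpace L] [IsUltrametricDist L] [Algebra K L]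
    (hi : DenseRange (algebraMap K L)) [IsAlgClosed K] : IsAlgClosed L := by
  apply IsAlgClosed.of_exists_root
  intro f hf firr
  have hn : f.natDegree ≠ 0 := (Irreducible.natDegree_pos firr).ne'
  let F := f.SplittingField
  let : NormedField F := spectralNorm.normedField L F
  let : NormedAlgebra L F := spectralNorm.normedAlgebra L F
  have hdeg := degree_ne_of_natDegree_ne (n := 0) hn
  let a := rootOfSplits (SplittingField.splits f) (by simpa using hdeg)
  have ha : f.aeval a = 0 := by
    rw [← eval_map_algebraMap]
    exact eval_rootOfSplits (SplittingField.splits f) (by simpa using hdeg)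
  have hclosed : IsClosed (Set.range (algebraMap L F)) :=
    (algebraMap_isometry L F).isClosedEmbedding.isClosed_range
  obtain ⟨x, hx⟩ : a ∈ Set.range (algebraMap L F) := by
    -- Roots depend continuously on coefficients: a monic `g` over `K` close to `f` has a root close
    -- to `a`, and that root lies in the image of `L`, which is closed. The constant `ε` below makes
    -- the distance bound exactly `δ`.
    rw [← hclosed.closure_eq, Metric.mem_closure_iff]
    intro δ hδ
    have hm : 0 < max ‖a‖ 1 := by positivity
    have hε : 0 < (δ / max ‖a‖ 1) ^ f.natDegree / (f.natDegree + 1) := by positivity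
    obtain ⟨g, gmon, gdeg, gcoeff⟩ :=
      exists_monic_and_natDegree_eq_and_norm_map_algebraMap_coeff_sub_lt hi hf hε
    obtain ⟨b, hb, hab⟩ := exists_aroots_norm_sub_lt_of_norm_coeff_sub_lt hε ha hf (gmon.map _)
      (gdeg ▸ g.natDegree_map _) gcoeff
      (by simpa [Polynomial.map_map] using (IsAlgClosed.splits g).map ((algebraMap L F).comp _))
    rw [mul_div_cancel₀ _ (by positivity), Real.pow_rpow_inv_natCast (by positivity) hn,
      div_mul_cancel₀ _ hm.ne'] at hab
    rw [aroots_def, Splits.roots_map ((IsAlgClosed.splits g).map _), Multiset.mem_map] at hb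
    obtain ⟨y, _, rfl⟩ := hb
    exact ⟨_, ⟨y, rfl⟩, by rwa [dist_eq_norm]⟩
  refine ⟨x, (algebraMap L F).injective ?_⟩
  rwa [← aeval_algebraMap_apply_eq_algebraMap_eval, hx, map_zero]

end AlgClosed

/-! ### Ultrametric inequalities -/

section Ultrametric

variable {E : Type*} [SeminormedAddCommGroup E] [IsUltrametricDist E]

theorem norm_sub_le_max_of_isUltrametricDist (x y : E) : ‖x - y‖ ≤ max ‖x‖ ‖y‖ := by
  simpa [sub_eq_add_neg] using IsUltrametricDist.norm_add_le_max x (-y)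

theorem norm_sub_eq_max_of_norm_ne_norm {x y : E} (h : ‖x‖ ≠ ‖y‖) : ‖x - y‖ = max ‖x‖ ‖y‖ := by
  simpa [sub_eq_add_neg] using
    IsUltrametricDist.norm_add_eq_max_of_norm_ne_norm (x := x) (y := -y) (by simpa using h)

theorem norm_sub_le_max_norm_sub (x y z : E) : ‖x - z‖ ≤ max ‖x - y‖ ‖y - z‖ := by
  simpa using IsUltrametricDist.norm_add_le_max (x - y) (y - z)

end Ultrametric

/-! ### Values at generic points of discs and the three circles theorem -/

section GenericValue

open Polynomial

variable {C : Type*} [NontriviallyNormedField C]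

/-- The absolute value of `P` at the generic point of the disc of centre `c` and radius `t`, in
terms of the roots of `P`. -/
def genericValue (c : C) (t : ℝ) (P : C[X]) : ℝ :=
  ‖P.leadingCoeff‖ * (P.roots.map fun a => max ‖c - a‖ t).prod

theorem continuous_genericValue (c : C) (P : C[X]) :
    Continuous fun t => genericValue c t P :=
  continuous_const.mul (continuous_multiset_prod _ fun _ _ => continuous_const.max continuous_id)

theorem genericValue_nonneg {c : C} {t : ℝ} {P : C[X]} : 0 ≤ genericValue c t P :=
  mul_nonneg (norm_nonneg _) (Multiset.prod_nonneg fun x hx => by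
    obtain ⟨a, _, rfl⟩ := Multiset.mem_map.1 hx
    exact le_max_of_le_left (norm_nonneg _))

theorem genericValue_pos {c : C} {t : ℝ} (ht : 0 < t) {P : C[X]} (hP : P ≠ 0) :
    0 < genericValue c t P :=
  mul_pos (norm_pos_iff.2 (leadingCoeff_ne_zero.2 hP)) (Multiset.prod_pos fun x hx => by
    obtain ⟨a, _, rfl⟩ := Multiset.mem_map.1 hx
    exact lt_max_of_lt_right ht)

theorem norm_eval_eq_prod_roots [IsAlgClosed C] (P : C[X]) (z : C) :
    ‖P.eval z‖ = ‖P.leadingCoeff‖ * (P.roots.map fun a => ‖z - a‖).prod := by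
  rw [(IsAlgClosed.splits P).eval_eq_prod_roots, norm_mul]
  congr 1
  rw [show ‖(P.roots.map fun a => z - a).prod‖ = normHom (P.roots.map fun a => z - a).prod from rfl,
    map_multiset_prod, Multiset.map_map]
  rfl

theorem norm_eval_eq_genericValue [IsAlgClosed C] {P : C[X]} {c z : C} {t : ℝ}
    (h : ∀ a ∈ P.roots, ‖z - a‖ = max ‖c - a‖ t) : ‖P.eval z‖ = genericValue c t P := by
  rw [norm_eval_eq_prod_roots, genericValue, Multiset.map_congr rfl h]

theorem genericValue_zero [IsAlgClosed C] (P : C[X]) (c : C) :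
    genericValue c 0 P = ‖P.eval c‖ :=
  (norm_eval_eq_genericValue fun _ _ => (max_eq_left (norm_nonneg _)).symm).symm

/-- Any point of an ultrametric disc is a centre of it. This is how information passes from one
point to another. -/
theorem genericValue_congr_center [IsUltrametricDist C] {c c' : C} {t : ℝ} (h : ‖c - c'‖ ≤ t)
    (P : C[X]) : genericValue c t P = genericValue c' t P := by
  have key : ∀ {c c' : C}, ‖c - c'‖ ≤ t → ∀ a, max ‖c - a‖ t ≤ max ‖c' - a‖ t := by
    intro c c' h a
    refine max_le ?_ (le_max_right _ _)
    rw [← sub_add_sub_cancel c c' a]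
    exact (IsUltrametricDist.norm_add_le_max _ _).trans
      (max_le (h.trans (le_max_right _ _)) (le_max_left _ _))
  unfold genericValue
  congr 2
  exact Multiset.map_congr rfl fun a _ =>
    le_antisymm (key h a) (key (by rwa [norm_sub_rev]) a)

/-- Take `u` with `∏ (u - b) = 1` over the `b` in the closed unit disc: all factors have norm at
most `1`, hence exactly `1`. Including `b = 0` makes the polynomial nonconstant and gives `‖u‖ = 1`.
-/
theorem exists_norm_eq_one_of_norm_sub [IsUltrametricDist C] [IsAlgClosed C] (S : Finset C) :
    ∃ u : C, ‖u‖ = 1 ∧ ∀ b ∈ S, ‖u - b‖ = max 1 ‖b‖ := by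
  classical
  set S' := insert 0 (S.filter fun b => ‖b‖ ≤ 1)
  have hS' : ∀ b ∈ S', ‖b‖ ≤ 1 := by
    intro b hb
    rcases Finset.mem_insert.1 hb with rfl | hb
    · simp
    · exact (Finset.mem_filter.1 hb).2
  obtain ⟨u, hu⟩ := IsAlgClosed.exists_root
    ((∏ b ∈ S', (X - Polynomial.C b)) - Polynomial.C (1 : C)) (by
    rw [degree_sub_C, degree_prod]
    · simp [S']
    · rw [degree_prod]
      simp only [degree_X_sub_C, Finset.sum_const, nsmul_eq_mul, mul_one]
      exact_mod_cast Finset.card_pos.2 ⟨0, Finset.mem_insert_self _ _⟩)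
  have hprod : ∏ b ∈ S', ‖u - b‖ = 1 := by
    rw [IsRoot, eval_sub, eval_prod, eval_C, sub_eq_zero] at hu
    simpa using congrArg norm hu
  have hu1 : ‖u‖ ≤ 1 := by
    by_contra! h
    have : ∀ b ∈ S', ‖u - b‖ = ‖u‖ := fun b hb =>
      norm_sub_eq_max_of_norm_ne_norm ((hS' b hb).trans_lt h).ne' |>.trans
        (max_eq_left ((hS' b hb).trans h.le))
    rw [Finset.prod_congr rfl this, Finset.prod_const] at hprod
    exact (one_lt_pow₀ h (Finset.card_pos.2 ⟨0, Finset.mem_insert_self _ _⟩).ne').ne' hprod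
  have hle : ∀ b ∈ S', ‖u - b‖ ≤ 1 := fun b hb =>
    (norm_sub_le_max_of_isUltrametricDist u b).trans (max_le hu1 (hS' b hb))
  have heq : ∀ b ∈ S', ‖u - b‖ = 1 := by
    intro b hb
    refine le_antisymm (hle b hb) ?_
    rw [← hprod, ← Finset.mul_prod_erase _ _ hb]
    exact mul_le_of_le_one_right (norm_nonneg _) (Finset.prod_le_one (fun _ _ => norm_nonneg _)
      fun b' hb' => hle b' (Finset.mem_of_mem_erase hb'))
  have hu1 : ‖u‖ = 1 := by simpa using heq 0 (Finset.mem_insert_self _ _)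
  refine ⟨u, hu1, fun b hb => ?_⟩
  by_cases h : ‖b‖ ≤ 1
  · rw [heq b (Finset.mem_insert_of_mem (Finset.mem_filter.2 ⟨hb, h⟩)), max_eq_left h]
  · push Not at h
    rw [norm_sub_eq_max_of_norm_ne_norm (by rw [hu1]; exact h.ne), hu1]

/-- Over an algebraically closed ultrametric field, there are points in general position with
respect to a finite set on every circle with radius in the value group. -/
theorem exists_generic [IsUltrametricDist C] [IsAlgClosed C] (c : C) {τ : C} (hτ : τ ≠ 0)
    (S : Finset C) : ∃ z : C, ‖z - c‖ = ‖τ‖ ∧ ∀ a ∈ S, ‖z - a‖ = max ‖c - a‖ ‖τ‖ := by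
  classical
  obtain ⟨u, hu, hS⟩ := exists_norm_eq_one_of_norm_sub (S.image fun a => (a - c) / τ)
  refine ⟨c + τ * u, by simp [hu], fun a ha => ?_⟩
  have h := hS _ (Finset.mem_image_of_mem _ ha)
  have : c + τ * u - a = τ * (u - (a - c) / τ) := by field_simp; ring
  rw [this, norm_mul, h, mul_max_of_nonneg _ _ (norm_nonneg _), mul_one, ← norm_mul,
    mul_div_cancel₀ _ hτ, norm_sub_rev, max_comm]

/-- The value group is dense: a root `w` of high order of an element of norm greater than `1` has
norm so close to `1` that its powers cannot jump over the interval. -/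
theorem exists_norm_mem_Ioo [IsAlgClosed C] {x y : ℝ} (hx : 0 ≤ x) (hxy : x < y) :
    ∃ τ : C, τ ≠ 0 ∧ x < ‖τ‖ ∧ ‖τ‖ < y := by
  obtain ⟨b, hb⟩ := NormedField.exists_one_lt_norm C
  obtain ⟨x', hx', hx'y⟩ := exists_between hxy
  have hx'0 : 0 < x' := hx.trans_lt hx'
  obtain ⟨n, hn, hn0⟩ : ∃ n : ℕ, ‖b‖ < (y / x') ^ n ∧ n ≠ 0 := by
    obtain ⟨n, hn⟩ := pow_unbounded_of_one_lt ‖b‖ ((one_lt_div hx'0).2 hx'y)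
    refine ⟨n, hn, ?_⟩
    rintro rfl
    rw [pow_zero] at hn
    linarith
  obtain ⟨w, hw⟩ := IsAlgClosed.exists_pow_nat_eq b (Nat.pos_of_ne_zero hn0)
  have hw1 : 1 < ‖w‖ := by
    by_contra! h
    rw [← hw, norm_pow] at hb
    exact absurd (pow_le_one₀ (norm_nonneg _) h) (not_le.2 hb)
  have hwy : ‖w‖ < y / x' := by
    rw [← hw, norm_pow] at hn
    exact lt_of_pow_lt_pow_left₀ n (div_pos (hx'0.trans hx'y) hx'0).le hn
  obtain ⟨m, hm, hm'⟩ := exists_mem_Ioc_zpow hx'0 hw1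
  refine ⟨w ^ (m + 1), zpow_ne_zero _ (norm_pos_iff.1 (by linarith)), ?_, ?_⟩
  · rw [norm_zpow]; linarith
  · rw [norm_zpow, zpow_add_one₀ (by linarith)]
    rw [lt_div_iff₀ hx'0] at hwy
    nlinarith [norm_nonneg w]

/-- Each factor `max a t` is log-convex as a function of `log t`. -/
theorem Multiset.prod_map_max_le_rpow (s : Multiset ℝ) (hs : ∀ a ∈ s, 0 ≤ a) {x y θ : ℝ}
    (hx : 0 < x) (hy : 0 < y) (h0 : 0 < θ) (h1 : θ < 1) :
    (s.map fun a => max a (x ^ (1 - θ) * y ^ θ)).prod ≤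
      (s.map fun a => max a x).prod ^ (1 - θ) * (s.map fun a => max a y).prod ^ θ := by
  induction s using Multiset.induction_on with
  | empty => simp
  | cons a s ih =>
    have ha := hs a (Multiset.mem_cons_self a s)
    have ih := ih fun b hb => hs b (Multiset.mem_cons_of_mem hb)
    have hpos : ∀ t : ℝ, 0 < t → 0 < (s.map fun a => max a t).prod := fun t ht =>
      Multiset.prod_pos fun x hx => by
        obtain ⟨a, _, rfl⟩ := Multiset.mem_map.1 hx
        exact lt_max_of_lt_right ht
    simp only [Multiset.map_cons, Multiset.prod_cons]
    rw [Real.mul_rpow (by positivity) (hpos x hx).le, Real.mul_rpow (by positivity) (hpos y hy).le,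
      mul_mul_mul_comm]
    refine mul_le_mul ?_ ih (hpos _ (by positivity)).le (by positivity)
    have h1' : 0 ≤ 1 - θ := by linarith
    refine max_le ?_ ?_
    · calc a = a ^ (1 - θ) * a ^ θ := by
            rw [← Real.rpow_add_of_nonneg ha h1' h0.le, sub_add_cancel, Real.rpow_one]
        _ ≤ _ := by gcongr <;> exact le_max_left _ _
    · gcongr <;> exact le_max_right _ _

/-- When `a` does not separate `x` from `y`, `max a t` is log-linear between them. This handles
denominators, whose roots avoid the relevant annulus. -/
theorem Multiset.rpow_le_prod_map_max (s : Multiset ℝ) (hs : ∀ a ∈ s, 0 ≤ a) {x y θ : ℝ}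
    (hx : 0 < x) (hy : 0 < y) (h0 : 0 < θ) (h1 : θ < 1)
    (hxy : ∀ a ∈ s, (a ≤ x ∧ a ≤ y) ∨ (x ≤ a ∧ y ≤ a)) :
    (s.map fun a => max a x).prod ^ (1 - θ) * (s.map fun a => max a y).prod ^ θ ≤
      (s.map fun a => max a (x ^ (1 - θ) * y ^ θ)).prod := by
  induction s using Multiset.induction_on with
  | empty => simp
  | cons a s ih =>
    have ha := hs a (Multiset.mem_cons_self a s)
    have ih := ih (fun b hb => hs b (Multiset.mem_cons_of_mem hb))
      fun b hb => hxy b (Multiset.mem_cons_of_mem hb)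
    have hpos : ∀ t : ℝ, 0 < t → 0 < (s.map fun a => max a t).prod := fun t ht =>
      Multiset.prod_pos fun x hx => by
        obtain ⟨a, _, rfl⟩ := Multiset.mem_map.1 hx
        exact lt_max_of_lt_right ht
    simp only [Multiset.map_cons, Multiset.prod_cons]
    rw [Real.mul_rpow (by positivity) (hpos x hx).le, Real.mul_rpow (by positivity) (hpos y hy).le,
      mul_mul_mul_comm]
    have hx' := hpos x hx
    have hy' := hpos y hy
    refine mul_le_mul ?_ ih (by positivity) (by positivity)
    have h1' : 0 ≤ 1 - θ := by linarith
    rcases hxy a (Multiset.mem_cons_self a s) with ⟨hax, hay⟩ | ⟨hxa, hya⟩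
    · rw [max_eq_right hax, max_eq_right hay]
      exact le_max_right _ _
    · rw [max_eq_left hxa, max_eq_left hya, ← Real.rpow_add_of_nonneg ha h1' h0.le,
        sub_add_cancel, Real.rpow_one]
      exact le_max_left _ _

/-- **Hadamard's three circles theorem** for rational functions over an ultrametric field. -/
theorem genericValue_div_le_rpow {c : C} {P Q : C[X]} (hQ : Q ≠ 0) {x y θ : ℝ} (hx : 0 < x)
    (hy : 0 < y) (h0 : 0 < θ) (h1 : θ < 1)
    (hxy : ∀ a ∈ Q.roots, (‖c - a‖ ≤ x ∧ ‖c - a‖ ≤ y) ∨ (x ≤ ‖c - a‖ ∧ y ≤ ‖c - a‖)) :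
    genericValue c (x ^ (1 - θ) * y ^ θ) P / genericValue c (x ^ (1 - θ) * y ^ θ) Q ≤
      (genericValue c x P / genericValue c x Q) ^ (1 - θ) *
        (genericValue c y P / genericValue c y Q) ^ θ := by
  have hsplit : ∀ r : ℝ, 0 ≤ r → r = r ^ (1 - θ) * r ^ θ := fun r hr => by
    rw [← Real.rpow_add_of_nonneg hr (by linarith) h0.le, sub_add_cancel, Real.rpow_one]
  have hprod : ∀ (R : C[X]) (t : ℝ), 0 ≤ (R.roots.map fun a => max ‖c - a‖ t).prod := fun R t =>
    Multiset.prod_nonneg fun x hx => by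
      obtain ⟨a, _, rfl⟩ := Multiset.mem_map.1 hx
      exact le_max_of_le_left (norm_nonneg _)
  have hP : genericValue c (x ^ (1 - θ) * y ^ θ) P ≤
      genericValue c x P ^ (1 - θ) * genericValue c y P ^ θ := by
    have := Multiset.prod_map_max_le_rpow (P.roots.map fun a => ‖c - a‖)
      (by rw [Multiset.forall_mem_map_iff]; exact fun _ _ => norm_nonneg _) hx hy h0 h1
    simp only [Multiset.map_map, Function.comp_def] at this
    unfold genericValue
    rw [Real.mul_rpow (norm_nonneg _) (hprod _ _), Real.mul_rpow (norm_nonneg _) (hprod _ _),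
      mul_mul_mul_comm, ← hsplit _ (norm_nonneg _)]
    exact mul_le_mul_of_nonneg_left this (norm_nonneg _)
  have hQ' : genericValue c x Q ^ (1 - θ) * genericValue c y Q ^ θ ≤
      genericValue c (x ^ (1 - θ) * y ^ θ) Q := by
    have := Multiset.rpow_le_prod_map_max (Q.roots.map fun a => ‖c - a‖)
      (by rw [Multiset.forall_mem_map_iff]; exact fun _ _ => norm_nonneg _) hx hy h0 h1
      (by rwa [Multiset.forall_mem_map_iff])
    simp only [Multiset.map_map, Function.comp_def] at this
    unfold genericValue
    rw [Real.mul_rpow (norm_nonneg _) (hprod _ _), Real.mul_rpow (norm_nonneg _) (hprod _ _),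
      mul_mul_mul_comm, ← hsplit _ (norm_nonneg _)]
    exact mul_le_mul_of_nonneg_left this (norm_nonneg _)
  rw [Real.div_rpow genericValue_nonneg genericValue_nonneg,
    Real.div_rpow genericValue_nonneg genericValue_nonneg, div_mul_div_comm]
  have := genericValue_pos (c := c) hx hQ
  have := genericValue_pos (c := c) hy hQ
  exact div_le_div₀ (mul_nonneg (Real.rpow_nonneg genericValue_nonneg _)
    (Real.rpow_nonneg genericValue_nonneg _)) hP (by positivity) hQ'

end GenericValue

/-! ### The ultrametric identity theorem on holed discs -/

section HoledDiscs

open Polynomial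

variable {C : Type*} [NontriviallyNormedField C]

/-- The holed disc of centre `a`, radius `‖ρ‖` and holes of centres `c j` and radii `‖s j‖`. -/
def holedDisc (a ρ : C) {m : ℕ} (c s : Fin m → C) : Set C :=
  Metric.closedBall a ‖ρ‖ \ ⋃ j, Metric.ball (c j) ‖s j‖

theorem mem_holedDisc {a ρ : C} {m : ℕ} {c s : Fin m → C} {z : C} :
    z ∈ holedDisc a ρ c s ↔ ‖z - a‖ ≤ ‖ρ‖ ∧ ∀ j, ‖s j‖ ≤ ‖z - c j‖ := by
  simp [holedDisc, dist_eq_norm]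

variable [IsUltrametricDist C] {a ρ : C} {m : ℕ} {c s : Fin m → C}

theorem mem_holedDisc_of_generic {x z : C} (hx : x ∈ holedDisc a ρ c s) {t : ℝ} (ht : t ≤ ‖ρ‖)
    (hz : ‖z - x‖ = t) (hgen : ∀ j, ‖z - c j‖ = max ‖x - c j‖ t) : z ∈ holedDisc a ρ c s := by
  rw [mem_holedDisc] at hx ⊢
  exact ⟨(norm_sub_le_max_norm_sub z x a).trans (max_le (hz.trans_le ht) hx.1),
    fun j => (hx.2 j).trans ((le_max_left _ _).trans_eq (hgen j).symm)⟩

/-- A point of a hole is as far from `x` as the centre of the hole. Hence the distances from `x` to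
poles within radius `‖ρ‖` are among the finitely many `‖x - c j‖`, whatever the approximant. -/
theorem norm_sub_of_notMem_holedDisc {x b : C} (hx : x ∈ holedDisc a ρ c s)
    (hb : b ∉ holedDisc a ρ c s) : ‖ρ‖ < ‖x - b‖ ∨ ∃ j, ‖x - b‖ = ‖x - c j‖ := by
  rw [mem_holedDisc] at hx hb
  by_cases h : ‖b - a‖ ≤ ‖ρ‖
  · push Not at hb
    obtain ⟨j, hj⟩ := hb h
    refine Or.inr ⟨j, ?_⟩
    have := hj.trans_le (hx.2 j)
    rw [← sub_sub_sub_cancel_right x b (c j), norm_sub_eq_max_of_norm_ne_norm this.ne',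
      max_eq_left this.le]
  · refine Or.inl ?_
    push Not at h
    rw [norm_sub_rev, ← sub_sub_sub_cancel_right b x a,
      norm_sub_eq_max_of_norm_ne_norm (hx.1.trans_lt h).ne', max_eq_left (hx.1.trans h.le)]
    exact h

variable [IsAlgClosed C]

/-- Functions that are close on a holed disc are close at its generic points. -/
theorem genericValue_div_le_max {x : C} (hx : x ∈ holedDisc a ρ c s) {t ε : ℝ} (ht : 0 < t)
    (htρ : t ≤ ‖ρ‖) {P Q P' Q' : C[X]} (hQ : Q ≠ 0) (hQ' : Q' ≠ 0)
    (h : ∀ z ∈ holedDisc a ρ c s, ‖P.eval z / Q.eval z - P'.eval z / Q'.eval z‖ ≤ ε) :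
    genericValue x t P / genericValue x t Q ≤
      max (genericValue x t P' / genericValue x t Q') ε := by
  classical
  by_contra! hlt
  -- The radius `t` need not be in the value group; by continuity a strict inequality at `t`
  -- persists at some `‖τ‖ < t`, where generic points exist.
  have hcont : ∀ {P Q : C[X]}, Q ≠ 0 →
      ContinuousAt (fun t => genericValue x t P / genericValue x t Q) t := fun hQ =>
    (continuous_genericValue x _).continuousAt.div (continuous_genericValue x _).continuousAt
      (genericValue_pos ht hQ).ne'
  have hev := (((hcont (P := P') hQ').max continuousAt_const).eventually_lt (hcont (P := P) hQ) hlt)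
  obtain ⟨δ, hδ, hball⟩ := Metric.eventually_nhds_iff.1 hev
  obtain ⟨τ, hτ0, hτ1, hτ2⟩ := exists_norm_mem_Ioo (C := C) (x := max 0 (t - δ)) (y := t)
    (le_max_left _ _) (max_lt ht (by linarith))
  have hτ := @hball ‖τ‖ (by
    rw [Real.dist_eq, abs_lt]
    constructor <;> linarith [le_max_right 0 (t - δ)])
  obtain ⟨z, hz, hgen⟩ := exists_generic x hτ0 (P.roots.toFinset ∪ Q.roots.toFinset ∪
    P'.roots.toFinset ∪ Q'.roots.toFinset ∪ Finset.univ.image c)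
  simp only [Finset.mem_union, Multiset.mem_toFinset, Finset.mem_image, Finset.mem_univ,
    true_and] at hgen
  have hzD : z ∈ holedDisc a ρ c s :=
    mem_holedDisc_of_generic hx (hτ2.le.trans htρ) hz fun j => hgen _ (Or.inr ⟨j, rfl⟩)
  rw [← norm_eval_eq_genericValue (P := P) (z := z) (fun b hb => hgen b (by tauto)),
    ← norm_eval_eq_genericValue (P := Q) (z := z) (fun b hb => hgen b (by tauto)),
    ← norm_eval_eq_genericValue (P := P') (z := z) (fun b hb => hgen b (by tauto)),
    ← norm_eval_eq_genericValue (P := Q') (z := z) (fun b hb => hgen b (by tauto)),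
    ← norm_div, ← norm_div] at hτ
  refine not_le.2 hτ ?_
  have := IsUltrametricDist.norm_add_le_max (P'.eval z / Q'.eval z)
    (P.eval z / Q.eval z - P'.eval z / Q'.eval z)
  rw [add_sub_cancel] at this
  exact this.trans (max_le_max le_rfl (h z hzD))

/-- The function `h`, to be thought of as a uniform limit of rational functions on `D`, vanishes at
the generic point of the disc of centre `x` and radius `t`. -/
def VanishesGenerically (h : C → C) (D : Set C) (x : C) (t : ℝ) : Prop :=
  ∀ ε : ℝ, 0 < ε → ∀ P Q : C[X], (∀ z ∈ D, Q.eval z ≠ 0) →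
    (∀ z ∈ D, ‖h z - P.eval z / Q.eval z‖ < ε) →
    genericValue x t P / genericValue x t Q ≤ ε

variable {h : C → C} {x : C}

omit [IsUltrametricDist C] [IsAlgClosed C] in
theorem ne_zero_of_forall_eval_ne_zero {D : Set C} (hx : x ∈ D) {Q : C[X]}
    (hQ : ∀ z ∈ D, Q.eval z ≠ 0) : Q ≠ 0 := by
  rintro rfl
  exact hQ x hx eval_zero

omit [IsUltrametricDist C] [IsAlgClosed C] in
theorem VanishesGenerically.of_mem_closure {D : Set C} (hx : x ∈ D) {t : ℝ} (ht : 0 < t)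
    (hcl : t ∈ closure {t | VanishesGenerically h D x t}) : VanishesGenerically h D x t := by
  intro ε hε P Q hQ hPQ
  have hcont : ContinuousAt (fun t => genericValue x t P / genericValue x t Q) t :=
    (continuous_genericValue x _).continuousAt.div (continuous_genericValue x _).continuousAt
      (genericValue_pos ht (ne_zero_of_forall_eval_ne_zero hx hQ)).ne'
  have hfreq := mem_closure_iff_frequently.1 hcl
  exact le_of_tendsto_of_frequently hcont (hfreq.mono fun t' ht' => ht' ε hε P Q hQ hPQ)

/-- Three circles for an approximant of error `e`: its value is at most `e` at radius `t` and
bounded at radius `y`, so it tends to `0` with `e` at every radius strictly in between. -/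
theorem VanishesGenerically.of_strictBetween (hh : IsUniformLimitOfRational h (holedDisc a ρ c s))
    (hx : x ∈ holedDisc a ρ c s) {t y t' : ℝ} (ht : 0 < t) (hy : 0 < y) (htρ : t ≤ ‖ρ‖)
    (hyρ : y ≤ ‖ρ‖) (hbetween : (t < t' ∧ t' < y) ∨ (y < t' ∧ t' < t))
    (hbreak : ∀ j, (‖x - c j‖ ≤ t ∧ ‖x - c j‖ ≤ y) ∨ (t ≤ ‖x - c j‖ ∧ y ≤ ‖x - c j‖))
    (hvan : VanishesGenerically h (holedDisc a ρ c s) x t) :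
    VanishesGenerically h (holedDisc a ρ c s) x t' := by
  obtain ⟨θ, h0, h1, rfl⟩ : ∃ θ : ℝ, 0 < θ ∧ θ < 1 ∧ t' = t ^ (1 - θ) * y ^ θ := by
    have ht' : 0 < t' := by rcases hbetween with h | h <;> linarith
    have hne : Real.log y - Real.log t ≠ 0 := by
      rcases hbetween with h | h
      · exact (sub_pos.2 (Real.log_lt_log ht (h.1.trans h.2))).ne'
      · exact (sub_neg.2 (Real.log_lt_log hy (h.1.trans h.2))).ne
    refine ⟨(Real.log t' - Real.log t) / (Real.log y - Real.log t), ?_, ?_, ?_⟩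
    · rcases hbetween with h | h
      · exact div_pos (sub_pos.2 (Real.log_lt_log ht h.1))
          (sub_pos.2 (Real.log_lt_log ht (h.1.trans h.2)))
      · exact div_pos_of_neg_of_neg (sub_neg.2 (Real.log_lt_log ht' h.2))
          (sub_neg.2 (Real.log_lt_log hy (h.1.trans h.2)))
    · rcases hbetween with h | h
      · rw [div_lt_one (sub_pos.2 (Real.log_lt_log ht (h.1.trans h.2)))]
        linarith [Real.log_lt_log ht' h.2]
      · rw [div_lt_one_of_neg (sub_neg.2 (Real.log_lt_log hy (h.1.trans h.2)))]
        linarith [Real.log_lt_log hy h.1]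
    · rw [Real.rpow_def_of_pos ht, Real.rpow_def_of_pos hy, ← Real.exp_add]
      refine (Real.exp_log ht').symm.trans (congrArg Real.exp ?_)
      field_simp
      ring
  have ht' : 0 < t ^ (1 - θ) * y ^ θ := by positivity
  have ht'ρ : t ^ (1 - θ) * y ^ θ ≤ ‖ρ‖ := by rcases hbetween with h | h <;> linarith
  intro ε hε P Q hQ hPQ
  have hQ0 := ne_zero_of_forall_eval_ne_zero hx hQ
  -- Approximants of error `e ≤ ε` differ from `P / Q` by at most `ε`, so `M` bounds their values at
  -- radius `y` independently of `e`.
  set M := max (genericValue x y P / genericValue x y Q) ε with hM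
  have hlim : Filter.Tendsto (fun e : ℝ => e ^ (1 - θ) * M ^ θ) (𝓝[>] 0) (𝓝 0) := by
    have : Filter.Tendsto (fun e : ℝ => e ^ (1 - θ)) (𝓝 0) (𝓝 (0 ^ (1 - θ))) :=
      (Real.continuousAt_rpow_const 0 (1 - θ) (Or.inr (by linarith))).tendsto
    rw [Real.zero_rpow (by linarith)] at this
    simpa using (this.mono_left nhdsWithin_le_nhds).mul_const (M ^ θ)
  obtain ⟨e, he, he0, heε⟩ := ((hlim.eventually (gt_mem_nhds hε)).and
    (Ioo_mem_nhdsGT hε)).exists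
  obtain ⟨P', Q', hQ', hPQ'⟩ := hh e he0
  have hQ'0 := ne_zero_of_forall_eval_ne_zero hx hQ'
  have hdiff : ∀ z ∈ holedDisc a ρ c s,
      ‖P.eval z / Q.eval z - P'.eval z / Q'.eval z‖ ≤ ε := fun z hz =>
    (norm_sub_le_max_norm_sub _ (h z) _).trans
      (max_le (by rw [norm_sub_rev]; exact (hPQ z hz).le) ((hPQ' z hz).le.trans heε.le))
  have hM' : genericValue x y P' / genericValue x y Q' ≤ M :=
    genericValue_div_le_max hx hy hyρ hQ'0 hQ0 fun z hz => by
      rw [norm_sub_rev]; exact hdiff z hz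
  refine (genericValue_div_le_max hx ht' ht'ρ hQ0 hQ'0 hdiff).trans (max_le ?_ le_rfl)
  refine le_trans ?_ he.le
  refine (genericValue_div_le_rpow hQ'0 ht hy h0 h1 fun b hb => ?_).trans ?_
  · have hbD : b ∉ holedDisc a ρ c s := fun hbD => hQ' b hbD (isRoot_of_mem_roots hb)
    rcases norm_sub_of_notMem_holedDisc hx hbD with hρ | ⟨j, hj⟩
    · exact Or.inr ⟨htρ.trans hρ.le, hyρ.trans hρ.le⟩
    · rw [hj]; exact hbreak j
  · have h1' : 0 ≤ 1 - θ := by linarith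
    have := hvan e he0 P' Q' hQ' hPQ'
    have hnn : ∀ u, 0 ≤ genericValue x u P' / genericValue x u Q' := fun u =>
      div_nonneg genericValue_nonneg genericValue_nonneg
    exact mul_le_mul (Real.rpow_le_rpow (hnn _) this h1') (Real.rpow_le_rpow (hnn _) hM' h0.le)
      (Real.rpow_nonneg (hnn _) _) (Real.rpow_nonneg he0.le _)

theorem VanishesGenerically.of_between (hh : IsUniformLimitOfRational h (holedDisc a ρ c s))
    (hx : x ∈ holedDisc a ρ c s) {t y : ℝ} (ht : 0 < t) (hy : 0 < y) (htρ : t ≤ ‖ρ‖)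
    (hyρ : y ≤ ‖ρ‖)
    (hbreak : ∀ j, (‖x - c j‖ ≤ t ∧ ‖x - c j‖ ≤ y) ∨ (t ≤ ‖x - c j‖ ∧ y ≤ ‖x - c j‖))
    (hvan : VanishesGenerically h (holedDisc a ρ c s) x t) :
    VanishesGenerically h (holedDisc a ρ c s) x y := by
  refine VanishesGenerically.of_mem_closure hx hy ?_
  rcases lt_trichotomy t y with hty | rfl | hty
  · refine closure_mono (s := Set.Ioo t y) (fun t' ht' => ?_) ?_
    · exact hvan.of_strictBetween hh hx ht hy htρ hyρ (Or.inl ht') hbreak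
    · rw [closure_Ioo hty.ne]; exact Set.right_mem_Icc.2 hty.le
  · exact subset_closure hvan
  · refine closure_mono (s := Set.Ioo y t) (fun t' ht' => ?_) ?_
    · exact hvan.of_strictBetween hh hx ht hy htρ hyρ (Or.inr ht') hbreak
    · rw [closure_Ioo hty.ne]; exact Set.left_mem_Icc.2 hty.le

/-- The radii at which `h` vanishes generically form a clopen subset of the interval `(0, ‖ρ‖]`: for
`u` close enough to `t`, no `‖x - c j‖` lies strictly between them. -/
theorem VanishesGenerically.of_radius (hh : IsUniformLimitOfRational h (holedDisc a ρ c s))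
    (hx : x ∈ holedDisc a ρ c s) {t y : ℝ} (ht : 0 < t) (hy : 0 < y) (htρ : t ≤ ‖ρ‖)
    (hyρ : y ≤ ‖ρ‖) (hvan : VanishesGenerically h (holedDisc a ρ c s) x t) :
    VanishesGenerically h (holedDisc a ρ c s) x y := by
  have : PreconnectedSpace (Set.Ioc 0 ‖ρ‖) := Subtype.preconnectedSpace isPreconnected_Ioc
  let S : Set (Set.Ioc 0 ‖ρ‖) := {t | VanishesGenerically h (holedDisc a ρ c s) x t}
  have hS : IsClopen S := by
    constructor
    · refine isClosed_of_closure_subset fun t ht => ?_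
      refine VanishesGenerically.of_mem_closure hx t.2.1 ?_
      have := image_closure_subset_closure_image continuous_subtype_val ⟨t, ht, rfl⟩
      refine closure_mono ?_ this
      rintro _ ⟨t, ht, rfl⟩
      exact ht
    · rw [isOpen_iff_eventually]
      intro t ht
      have hev : ∀ᶠ u : ℝ in 𝓝 (t : ℝ), ∀ j,
          (‖x - c j‖ ≤ t ∧ ‖x - c j‖ ≤ u) ∨ (t ≤ ‖x - c j‖ ∧ u ≤ ‖x - c j‖) := by
        rw [Filter.eventually_all]
        intro j
        rcases lt_trichotomy ‖x - c j‖ (t : ℝ) with hj | hj | hj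
        · filter_upwards [lt_mem_nhds hj] with u hu using Or.inl ⟨hj.le, hu.le⟩
        · filter_upwards with u
          rw [hj]
          simpa using le_total (t : ℝ) u
        · filter_upwards [gt_mem_nhds hj] with u hu using Or.inr ⟨hj.le, hu.le⟩
      filter_upwards [continuous_subtype_val.continuousAt.eventually hev] with u hu
      exact VanishesGenerically.of_between hh hx t.2.1 u.2.1 t.2.2 u.2.2 hu ht
  have := hS.eq_univ ⟨⟨t, ht, htρ⟩, hvan⟩
  exact Set.eq_univ_iff_forall.1 this ⟨y, hy, hyρ⟩

/-- The identity theorem for uniform limits of rational functions on holed discs. -/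
theorem IsUniformLimitOfRational.eq_zero {D : Set C} (hD : IsHoledDisc D)
    (hh : IsUniformLimitOfRational h D) {y : C} (hx : x ∈ D) (hy : y ∈ D)
    (h0 : ∀ᶠ z in 𝓝 x, h z = 0) : h y = 0 := by
  classical
  obtain ⟨a, ρ, m, c, s, hρ, -, rfl⟩ := hD
  change IsUniformLimitOfRational h (holedDisc a ρ c s) at hh
  change x ∈ holedDisc a ρ c s at hx
  change y ∈ holedDisc a ρ c s at hy
  rcases eq_or_ne x y with rfl | hxy
  · exact h0.self_of_nhds
  have hT : 0 < ‖x - y‖ := norm_pos_iff.2 (sub_ne_zero.2 hxy)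
  have hTρ : ‖x - y‖ ≤ ‖ρ‖ := by
    rw [← sub_sub_sub_cancel_right x y a]
    exact (norm_sub_le_max_of_isUltrametricDist _ _).trans
      (max_le (mem_holedDisc.1 hx).1 (mem_holedDisc.1 hy).1)
  obtain ⟨δ, hδ, hball⟩ := Metric.eventually_nhds_iff.1 h0
  obtain ⟨τ, hτ0, -, hτ⟩ := exists_norm_mem_Ioo (C := C) le_rfl (lt_min hδ hT)
  have hτρ : ‖τ‖ ≤ ‖ρ‖ := (hτ.le.trans (min_le_right _ _)).trans hTρ
  -- On a small circle around `x` the function is zero, so an approximant is smaller than `ε` at a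
  -- generic point of it.
  have hstart : VanishesGenerically h (holedDisc a ρ c s) x ‖τ‖ := by
    intro ε hε P Q hQ hPQ
    obtain ⟨z, hz, hgen⟩ := exists_generic x hτ0 (P.roots.toFinset ∪ Q.roots.toFinset ∪
      Finset.univ.image c)
    simp only [Finset.mem_union, Multiset.mem_toFinset, Finset.mem_image, Finset.mem_univ,
      true_and] at hgen
    have hzD : z ∈ holedDisc a ρ c s :=
      mem_holedDisc_of_generic hx hτρ hz fun j => hgen _ (Or.inr ⟨j, rfl⟩)
    have := hPQ z hzD
    rw [hball (by rw [dist_eq_norm, hz]; exact hτ.trans_le (min_le_left _ _)), zero_sub, norm_neg,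
      norm_div,
      norm_eval_eq_genericValue (P := P) (c := x) (t := ‖τ‖) (fun b hb => hgen b (by tauto)),
      norm_eval_eq_genericValue (P := Q) (c := x) (t := ‖τ‖)
        (fun b hb => hgen b (by tauto))] at this
    exact this.le
  -- Increase the radius around `x` to `‖x - y‖`, change the centre to `y`, then move to the radius
  -- `t`. Letting `t` tend to `0` afterwards recovers the value at `y`.
  have hend : ∀ t, 0 < t → t ≤ ‖ρ‖ → VanishesGenerically h (holedDisc a ρ c s) y t := by
    intro t ht htρ
    refine VanishesGenerically.of_radius hh hy hT ht hTρ htρ ?_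
    intro ε hε P Q hQ hPQ
    rw [← genericValue_congr_center le_rfl, ← genericValue_congr_center le_rfl]
    exact hstart.of_radius hh hx (norm_pos_iff.2 hτ0) hT hτρ hTρ ε hε P Q hQ hPQ
  rw [← norm_le_zero_iff]
  refine le_of_forall_pos_le_add fun ε hε => ?_
  obtain ⟨P, Q, hQ, hPQ⟩ := hh ε hε
  have hlim : Filter.Tendsto (fun t => genericValue y t P / genericValue y t Q) (𝓝[>] 0)
      (𝓝 (‖P.eval y‖ / ‖Q.eval y‖)) := by
    rw [← genericValue_zero, ← genericValue_zero]
    refine (Filter.Tendsto.div (continuous_genericValue y P).continuousAt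
      (continuous_genericValue y Q).continuousAt ?_).mono_left nhdsWithin_le_nhds
    change genericValue y 0 Q ≠ 0
    rw [genericValue_zero]
    exact norm_ne_zero_iff.2 (hQ y hy)
  have hle : ‖P.eval y‖ / ‖Q.eval y‖ ≤ ε := by
    refine le_of_tendsto hlim ?_
    filter_upwards [Ioc_mem_nhdsGT (norm_pos_iff.2 hρ)] with t ht
    exact hend t ht.1 ht.2 ε hε P Q hQ hPQ
  rw [← norm_div] at hle
  have := IsUltrametricDist.norm_add_le_max (h y - P.eval y / Q.eval y) (P.eval y / Q.eval y)
  rw [sub_add_cancel] at this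
  rw [zero_add]
  exact this.trans (max_le (hPQ y hy).le hle)

end HoledDiscs

/-! ### Sums and products of uniform limits of rational functions -/

section UniformLimits

open Polynomial

variable {C : Type*} [NontriviallyNormedField C]

theorem exists_pos_le_norm {m : ℕ} {ρ : C} (hρ : ρ ≠ 0) {s : Fin m → C} (hs : ∀ j, s j ≠ 0) :
    ∃ δ : ℝ, 0 < δ ∧ δ ≤ ‖ρ‖ ∧ ∀ j, δ ≤ ‖s j‖ := by
  have h : ∀ᶠ δ : ℝ in 𝓝[>] 0, (0 < δ ∧ δ ≤ ‖ρ‖) ∧ ∀ j, 0 < δ ∧ δ ≤ ‖s j‖ :=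
    (Filter.Eventually.and (Ioc_mem_nhdsGT (norm_pos_iff.2 hρ))
      (Filter.eventually_all.2 fun j => Ioc_mem_nhdsGT (norm_pos_iff.2 (hs j))))
  obtain ⟨δ, h1, h2⟩ := h.exists
  exact ⟨δ, h1.1, h1.2, fun j => (h2 j).2⟩

/-- The poles stay at distance at least `δ`, the smallness bound for all radii, from every point of
`D`. Boundedness is needed to multiply uniform limits. -/
theorem exists_norm_div_le_of_isHoledDisc [IsUltrametricDist C] [IsAlgClosed C] {D : Set C}
    (hD : IsHoledDisc D) (P Q : C[X]) (hQ : ∀ z ∈ D, Q.eval z ≠ 0) :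
    ∃ M : ℝ, ∀ z ∈ D, ‖P.eval z / Q.eval z‖ ≤ M := by
  obtain ⟨a, ρ, m, c, s, hρ, hs, rfl⟩ := hD
  change ∀ z ∈ holedDisc a ρ c s, _ at hQ
  change ∃ M : ℝ, ∀ z ∈ holedDisc a ρ c s, _
  obtain ⟨δ, hδ, hδρ, hδs⟩ := exists_pos_le_norm hρ hs
  refine ⟨genericValue a ‖ρ‖ P / (‖Q.leadingCoeff‖ * δ ^ Q.roots.card), fun z hz => ?_⟩
  have hQ0 := ne_zero_of_forall_eval_ne_zero hz hQ
  have hlc : 0 < ‖Q.leadingCoeff‖ := norm_pos_iff.2 (leadingCoeff_ne_zero.2 hQ0)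
  rw [norm_div, norm_eval_eq_prod_roots, norm_eval_eq_prod_roots]
  refine div_le_div₀ genericValue_nonneg ?_ (by positivity) ?_
  · refine mul_le_mul_of_nonneg_left (Multiset.prod_map_le_prod_map₀ _ _
      (fun _ _ => norm_nonneg _) fun b _ => ?_) (norm_nonneg _)
    rw [max_comm]
    exact (norm_sub_le_max_norm_sub z a b).trans (max_le_max (mem_holedDisc.1 hz).1 le_rfl)
  · refine mul_le_mul_of_nonneg_left ?_ hlc.le
    have := Multiset.prod_map_le_prod_map₀ (s := Q.roots) (fun _ => δ) (fun b => ‖z - b‖)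
      (fun _ _ => hδ.le) fun b hb => by
        rcases norm_sub_of_notMem_holedDisc hz fun hbD => hQ b hbD (isRoot_of_mem_roots hb)
          with h | ⟨j, hj⟩
        · exact hδρ.trans h.le
        · rw [hj]
          exact (hδs j).trans ((mem_holedDisc.1 hz).2 j)
    simpa using this

theorem IsUniformLimitOfRational.exists_norm_le [IsUltrametricDist C] [IsAlgClosed C] {D : Set C}
    (hD : IsHoledDisc D) {f : C → C} (hf : IsUniformLimitOfRational f D) :
    ∃ M : ℝ, 0 ≤ M ∧ ∀ z ∈ D, ‖f z‖ ≤ M := by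
  obtain ⟨P, Q, hQ, hPQ⟩ := hf 1 one_pos
  obtain ⟨M, hM⟩ := exists_norm_div_le_of_isHoledDisc hD P Q hQ
  refine ⟨max 0 (M + 1), le_max_left _ _, fun z hz => le_max_of_le_right ?_⟩
  have := norm_add_le (f z - P.eval z / Q.eval z) (P.eval z / Q.eval z)
  rw [sub_add_cancel] at this
  linarith [hPQ z hz, hM z hz]

theorem isUniformLimitOfRational_eval (P : C[X]) (D : Set C) :
    IsUniformLimitOfRational (fun z => P.eval z) D := fun ε hε =>
  ⟨P, 1, by simp, by simpa using fun _ _ => hε⟩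

theorem IsUniformLimitOfRational.add {D : Set C} {f g : C → C} (hf : IsUniformLimitOfRational f D)
    (hg : IsUniformLimitOfRational g D) : IsUniformLimitOfRational (fun z => f z + g z) D := by
  intro ε hε
  obtain ⟨P, Q, hQ, hPQ⟩ := hf (ε / 2) (half_pos hε)
  obtain ⟨P', Q', hQ', hPQ'⟩ := hg (ε / 2) (half_pos hε)
  refine ⟨P * Q' + Q * P', Q * Q', fun z hz => by simpa using ⟨hQ z hz, hQ' z hz⟩, fun z hz => ?_⟩
  rw [eval_add, eval_mul, eval_mul, eval_mul, ← div_add_div _ _ (hQ z hz) (hQ' z hz),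
    add_sub_add_comm]
  exact (norm_add_le _ _).trans_lt (by linarith [hPQ z hz, hPQ' z hz])

theorem IsUniformLimitOfRational.mul [IsUltrametricDist C] [IsAlgClosed C] {D : Set C}
    (hD : IsHoledDisc D) {f g : C → C} (hf : IsUniformLimitOfRational f D)
    (hg : IsUniformLimitOfRational g D) : IsUniformLimitOfRational (fun z => f z * g z) D := by
  obtain ⟨M, hM0, hM⟩ := hf.exists_norm_le hD
  obtain ⟨N, hN0, hN⟩ := hg.exists_norm_le hD
  intro ε hε
  set e := min 1 (ε / (M + N + 1)) with he
  have he0 : 0 < e := lt_min one_pos (by positivity)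
  have heε : e * (M + N + 1) ≤ ε := (le_div_iff₀ (by positivity)).1 (min_le_right _ _)
  obtain ⟨P, Q, hQ, hPQ⟩ := hf e he0
  obtain ⟨P', Q', hQ', hPQ'⟩ := hg e he0
  refine ⟨P * P', Q * Q', fun z hz => by simpa using ⟨hQ z hz, hQ' z hz⟩, fun z hz => ?_⟩
  rw [eval_mul, eval_mul, mul_div_mul_comm]
  set R := P.eval z / Q.eval z
  set S := P'.eval z / Q'.eval z
  have hS : ‖S‖ ≤ N + 1 := by
    have := norm_sub_norm_le S (g z)
    rw [norm_sub_rev] at this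
    linarith [hPQ' z hz, hN z hz, min_le_left 1 (ε / (M + N + 1))]
  calc ‖f z * g z - R * S‖ = ‖f z * (g z - S) + (f z - R) * S‖ := by ring_nf
    _ ≤ ‖f z‖ * ‖g z - S‖ + ‖f z - R‖ * ‖S‖ := by
        rw [← norm_mul, ← norm_mul]; exact norm_add_le _ _
    _ < ε := by
        have h1 : ‖f z‖ * ‖g z - S‖ ≤ M * e :=
          mul_le_mul (hM z hz) (hPQ' z hz).le (norm_nonneg _) hM0
        have h2 : ‖f z - R‖ * ‖S‖ < e * (N + 1) :=
          mul_lt_mul_of_lt_of_le_of_nonneg_of_pos (hPQ z hz) hS (norm_nonneg _) (by positivity)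
        nlinarith

end UniformLimits

/-! ### Arithmetic of power series expansions at the origin -/

section Expansions

variable {K C : Type*} [Field K] [NontriviallyNormedField C] [Algebra K C]

/-- Abel's lemma: convergence at a nonzero `w` gives geometric domination for `‖z‖ < ‖w‖`. The
Cauchy product needs this absolute convergence. -/
theorem IsExpansionAtZero.eventually_summable_norm {F : PowerSeries K} {f : C → C}
    (h : IsExpansionAtZero F f) :
    ∀ᶠ z in 𝓝 (0 : C), Summable fun m => ‖algebraMap K C (PowerSeries.coeff m F) * z ^ m‖ := by
  obtain ⟨δ, hδ, hball⟩ := Metric.eventually_nhds_iff.1 h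
  obtain ⟨w, hw0, hw⟩ := NormedField.exists_norm_lt C hδ
  have hsum := (@hball w (by simpa using hw)).summable
  obtain ⟨M, hM⟩ := hsum.tendsto_atTop_zero.norm.bddAbove_range
  filter_upwards [Metric.ball_mem_nhds (0 : C) hw0] with z hz
  have hz : ‖z‖ < ‖w‖ := by simpa using hz
  refine Summable.of_nonneg_of_le (fun _ => norm_nonneg _) (fun m => ?_)
    ((summable_geometric_of_lt_one (by positivity) ((div_lt_one hw0).2 hz)).mul_left M)
  have : ‖algebraMap K C (PowerSeries.coeff m F) * w ^ m‖ ≤ M := hM ⟨m, rfl⟩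
  rw [norm_mul, norm_pow] at this ⊢
  calc _ = (‖algebraMap K C (PowerSeries.coeff m F)‖ * ‖w‖ ^ m) * (‖z‖ / ‖w‖) ^ m := by
        rw [div_pow]; field_simp
    _ ≤ _ := by gcongr

theorem IsExpansionAtZero.add {F G : PowerSeries K} {f g : C → C} (hf : IsExpansionAtZero F f)
    (hg : IsExpansionAtZero G g) : IsExpansionAtZero (F + G) fun z => f z + g z := by
  filter_upwards [hf, hg] with z hf hg
  simpa [add_mul] using hf.add hg

theorem IsExpansionAtZero.mul [CompleteSpace C] {F G : PowerSeries K} {f g : C → C}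
    (hf : IsExpansionAtZero F f) (hg : IsExpansionAtZero G g) :
    IsExpansionAtZero (F * G) fun z => f z * g z := by
  filter_upwards [hf, hg, hf.eventually_summable_norm, hg.eventually_summable_norm]
    with z hf hg hf' hg'
  have hterm : (fun m => algebraMap K C (PowerSeries.coeff m (F * G)) * z ^ m) = fun m =>
      ∑ kl ∈ Finset.HasAntidiagonal.antidiagonal m,
        (algebraMap K C (PowerSeries.coeff kl.1 F) * z ^ kl.1) *
        (algebraMap K C (PowerSeries.coeff kl.2 G) * z ^ kl.2) := by
    ext m
    rw [PowerSeries.coeff_mul, map_sum, Finset.sum_mul]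
    refine Finset.sum_congr rfl fun kl hkl => ?_
    rw [← Finset.HasAntidiagonal.mem_antidiagonal.1 hkl, map_mul, pow_add]
    ring
  rw [hterm, ← hf.tsum_eq, ← hg.tsum_eq,
    tsum_mul_tsum_eq_tsum_sum_antidiagonal_of_summable_norm hf' hg']
  exact (summable_norm_sum_mul_antidiagonal_of_summable_norm hf' hg').of_norm.hasSum

theorem isExpansionAtZero_polynomial (p : Polynomial K) :
    IsExpansionAtZero (p : PowerSeries K) fun z : C => Polynomial.aeval z p := by
  refine Filter.Eventually.of_forall fun z => ?_
  beta_reduce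
  rw [Polynomial.aeval_eq_sum_range]
  simp only [Algebra.smul_def, Polynomial.coeff_coe]
  refine hasSum_sum_of_ne_finset_zero fun m hm => ?_
  rw [Polynomial.coeff_eq_zero_of_natDegree_lt (by simpa using hm), map_zero, zero_mul]

theorem IsExpansionAtZero.eventually_eq_zero {f : C → C}
    (h : IsExpansionAtZero (0 : PowerSeries K) f) : ∀ᶠ z in 𝓝 (0 : C), f z = 0 := by
  filter_upwards [h] with z hz
  exact hz.unique (by simp)

end Expansions

/-! ### Polynomial expressions in the functions -/

section PolynomialExpressions

open scoped RatFunc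

variable {m : ℕ} {K C : Type*} [Field K] [NontriviallyNormedField C] [Algebra K C]

/-- The function `z ↦ q(z, f(z))`. -/
def evalAlong (f : Fin m → C → C) (q : MvPolynomial (Fin m) (Polynomial K)) (z : C) : C :=
  MvPolynomial.eval₂ (Polynomial.aeval z : Polynomial K →ₐ[K] C).toRingHom (fun i => f i z) q

variable (f : Fin m → C → C)

theorem evalAlong_C (p : Polynomial K) :
    evalAlong f (MvPolynomial.C p) = fun z => Polynomial.aeval z p := by
  ext z; simp [evalAlong]

theorem evalAlong_add (p q : MvPolynomial (Fin m) (Polynomial K)) :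
    evalAlong f (p + q) = fun z => evalAlong f p z + evalAlong f q z := by
  ext z; simp [evalAlong]

theorem evalAlong_mul_X (p : MvPolynomial (Fin m) (Polynomial K)) (i : Fin m) :
    evalAlong f (p * MvPolynomial.X i) = fun z => evalAlong f p z * f i z := by
  ext z; simp [evalAlong]

theorem evalAlong_algebraMap (q : MvPolynomial (Fin m) (Polynomial K)) (α : K) :
    evalAlong f q (algebraMap K C α) =
      MvPolynomial.aeval (fun i => f i (algebraMap K C α)) (evAt α q) := by
  induction q using MvPolynomial.induction_on with
  | C p => simp [evalAlong_C, evAt, Polynomial.aeval_algebraMap_apply_eq_algebraMap_eval]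
  | add p q hp hq => simp [evalAlong_add, hp, hq]
  | mul_X p i hp =>
    rw [evalAlong_mul_X]
    beta_reduce
    rw [hp]
    simp [evAt]

variable {f}

theorem isExpansionAtZero_evalAlong [CompleteSpace C] {F : Fin m → PowerSeries K}
    (hF : ∀ i, IsExpansionAtZero (F i) (f i)) (q : MvPolynomial (Fin m) (Polynomial K)) :
    IsExpansionAtZero (MvPolynomial.eval₂ Polynomial.coeToPowerSeries.ringHom F q)
      (evalAlong f q) := by
  induction q using MvPolynomial.induction_on with
  | C p => simpa [evalAlong_C] using isExpansionAtZero_polynomial (C := C) p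
  | add p q hp hq => simpa [evalAlong_add] using hp.add hq
  | mul_X p i hp => simpa [evalAlong_mul_X] using hp.mul (hF i)

theorem analyticOnNhd_evalAlong {U : Set C} (hf : ∀ i, AnalyticOnNhd C (f i) U)
    (q : MvPolynomial (Fin m) (Polynomial K)) : AnalyticOnNhd C (evalAlong f q) U := by
  induction q using MvPolynomial.induction_on with
  | C p =>
    have : AnalyticOnNhd C (fun z => Polynomial.aeval z (p.map (algebraMap K C))) U :=
      fun z _ => AnalyticAt.aeval_polynomial analyticAt_id _
    simpa [evalAlong_C] using this
  | add p q hp hq => rw [evalAlong_add]; exact hp.add hq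
  | mul_X p i hp => rw [evalAlong_mul_X]; exact hp.mul (hf i)

theorem isUniformLimitOfRational_evalAlong [IsUltrametricDist C] [IsAlgClosed C] {D : Set C}
    (hD : IsHoledDisc D) (hf : ∀ i, IsUniformLimitOfRational (f i) D)
    (q : MvPolynomial (Fin m) (Polynomial K)) : IsUniformLimitOfRational (evalAlong f q) D := by
  induction q using MvPolynomial.induction_on with
  | C p =>
    simpa [evalAlong_C] using isUniformLimitOfRational_eval (p.map (algebraMap K C)) D
  | add p q hp hq => rw [evalAlong_add]; exact hp.add hq
  | mul_X p i hp => rw [evalAlong_mul_X]; exact hp.mul hD (hf i)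

theorem coe_eval₂_powerSeries (F : Fin m → PowerSeries K)
    (q : MvPolynomial (Fin m) (Polynomial K)) :
    ((MvPolynomial.eval₂ Polynomial.coeToPowerSeries.ringHom F q : PowerSeries K) :
        LaurentSeries K) =
      MvPolynomial.aeval (fun i => (F i : LaurentSeries K)) (toRatFunc q) := by
  induction q using MvPolynomial.induction_on with
  | C p => simp [toRatFunc, RatFunc.coe_coe]
  | add p q hp hq => simp [hp, hq]
  | mul_X p i hp =>
    rw [MvPolynomial.eval₂_mul, MvPolynomial.eval₂_X, map_mul, hp]
    simp [toRatFunc]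

/-- The formal relation says that the expansion at `0` is zero; the identity theorem carries the
vanishing to `x`, on a holed disc joining `0` to `x` in the ultrametric case. -/
theorem evalAlong_eq_zero [CompleteSpace C] (halg : IsUltrametricDist C → IsAlgClosed C)
    {U : Set C} (hU : IsAnalyticDomain U) (h0 : (0 : C) ∈ U) {f : Fin m → C → C}
    (hf : ∀ i, IsAnalyticOnDomain (f i) U) {F : Fin m → PowerSeries K}
    (hF : ∀ i, IsExpansionAtZero (F i) (f i)) {q : MvPolynomial (Fin m) (Polynomial K)}
    (hq : MvPolynomial.aeval (fun i => (F i : LaurentSeries K)) (toRatFunc q) = 0) {x : C}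
    (hx : x ∈ U) : evalAlong f q x = 0 := by
  have hexp := isExpansionAtZero_evalAlong hF q
  rw [← coe_eval₂_powerSeries, map_eq_zero_iff _ HahnSeries.ofPowerSeries_injective] at hq
  rw [hq] at hexp
  rcases hU with ⟨hu, -, hconn⟩ | ⟨hu, -, hU⟩
  · exact (analyticOnNhd_evalAlong (fun i => ((hf i).resolve_right fun h => hu h.1).2)
      q).eqOn_zero_of_preconnected_of_eventuallyEq_zero hconn.isPreconnected h0
        hexp.eventually_eq_zero hx
  · have := halg hu
    obtain ⟨D, hD, hDU, h0D, hxD⟩ := hU 0 h0 x hx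
    exact (isUniformLimitOfRational_evalAlong hD (fun i =>
      ((hf i).resolve_left fun h => h.1 hu).2 D hD hDU) q).eq_zero hD h0D hxD
        hexp.eventually_eq_zero

end PolynomialExpressions

/-! ### Algebraic closedness of the constant field -/

section AlgebraicClosures

variable {k C : Type*} [NontriviallyNormedField k] [NontriviallyNormedField C] [NormedAlgebra k C]

theorem IsCompletedAlgClosure.isAlgClosed_of_isUltrametricDist [IsUltrametricDist C]
    (hC : IsCompletedAlgClosure k C) : IsAlgClosed C := by
  have := hC.complete
  have := hC.isAlgClosed
  refine isAlgClosed_of_denseRange_of_isUltrametricDist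
    (K := algebraicClosure (closureIn k C) C) ?_
  have := hC.dense
  rw [← Subtype.range_coe (s := (algebraicClosure (closureIn k C) C : Set C))] at this
  exact this

theorem algebraicClosure_le_algebraicClosure_closureIn {x : C} (hx : x ∈ algebraicClosure k C) :
    x ∈ algebraicClosure (closureIn k C) C := by
  let i : k →+* closureIn k C := (algebraMap k C).codRestrict _ fun a =>
    Subfield.le_topologicalClosure _ ⟨a, rfl⟩
  let : Algebra k (closureIn k C) := i.toAlgebra
  have : IsScalarTower k (closureIn k C) C := .of_algebraMap_eq fun a => rfl
  rw [mem_algebraicClosure_iff] at hx ⊢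
  exact hx.tower_top _

/-- Roots exist in the larger algebraic closure of `closureIn k C`, and are algebraic over `k` by
transitivity. -/
theorem IsCompletedAlgClosure.isAlgClosed_algebraicClosure (hC : IsCompletedAlgClosure k C) :
    IsAlgClosed (algebraicClosure k C) := by
  have := hC.isAlgClosed
  apply IsAlgClosed.of_exists_root
  intro p hp hirr
  let i : algebraicClosure k C →+* algebraicClosure (closureIn k C) C :=
    (algebraMap (algebraicClosure k C) C).codRestrict _ fun a =>
      algebraicClosure_le_algebraicClosure_closureIn a.2
  obtain ⟨y, hy⟩ := IsAlgClosed.exists_root (p.map i) (by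
    rw [Polynomial.degree_map]
    exact (Polynomial.degree_pos_of_irreducible hirr).ne')
  have hyC : Polynomial.aeval (y : C) p = 0 := by
    have := congrArg (algebraMap (algebraicClosure (closureIn k C) C) C) hy
    rw [map_zero, Polynomial.eval_map, Polynomial.hom_eval₂] at this
    exact this
  have halg : IsAlgebraic k (y : C) :=
    IsAlgebraic.restrictScalars k (S := algebraicClosure k C) ⟨p, hp.ne_zero, hyC⟩
  refine ⟨⟨y, mem_algebraicClosure_iff.2 halg⟩, Subtype.val_injective ?_⟩
  have : Polynomial.aeval (algebraMap (algebraicClosure k C) C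
    ⟨y, mem_algebraicClosure_iff.2 halg⟩) p = 0 := hyC
  rw [Polynomial.aeval_algebraMap_apply_eq_algebraMap_eval] at this
  exact this

end AlgebraicClosures

/-! ### From homogenized ideals to homogeneous relations -/

section HomogenizedIdeals

open MvPolynomial
open scoped RatFunc

attribute [local instance] MvPolynomial.gradedAlgebra

theorem isHomogeneous_homogenizedIdeal {R : Type*} [CommRing R] {n : ℕ}
    (q : Ideal (MvPolynomial (Fin n) R)) :
    (homogenizedIdeal q).IsHomogeneous (homogeneousSubmodule (Fin (n + 1)) R) :=
  Ideal.homogeneous_span _ _ fun _ hQ => hQ.1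

theorem dehomogenize_mem_of_mem_homogenizedIdeal {R : Type*} [CommRing R] {n : ℕ}
    {q : Ideal (MvPolynomial (Fin n) R)} {Q : MvPolynomial (Fin (n + 1)) R}
    (hQ : Q ∈ homogenizedIdeal q) :
    aeval (Fin.cons 1 X : Fin (n + 1) → MvPolynomial (Fin n) R) Q ∈ q := by
  have : homogenizedIdeal q ≤
      q.comap (aeval (Fin.cons 1 X : Fin (n + 1) → MvPolynomial (Fin n) R)) :=
    Ideal.span_le.2 fun _ hP => hP.2
  exact this hQ

theorem aeval_dehomogenize {R A : Type*} [CommRing R] [CommRing A] [Algebra R A] {n : ℕ}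
    (u : Fin n → A) (Q : MvPolynomial (Fin (n + 1)) R) :
    aeval u (aeval (Fin.cons 1 X : Fin (n + 1) → MvPolynomial (Fin n) R) Q) =
      aeval (Fin.cons 1 u : Fin (n + 1) → A) Q := by
  rw [← AlgHom.comp_apply]
  congr 1
  ext i
  refine Fin.cases ?_ (fun i => ?_) i <;> simp

theorem homogeneousComponent_map {R S σ : Type*} [CommRing R] [CommRing S] (f : R →+* S) (d : ℕ)
    (Q : MvPolynomial σ R) :
    homogeneousComponent d (map f Q) = map f (homogeneousComponent d Q) := by
  ext s
  simp only [coeff_homogeneousComponent, coeff_map]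
  split_ifs <;> simp

variable {K : Type*} [Field K] {n : ℕ} {F : Fin n → PowerSeries K}

/-- The homogeneous components of an element of `𝔭̃ ∩ K[z][X₀, …, Xₙ]` are relations. -/
theorem aeval_homogeneousComponent_eq_zero {Q : MvPolynomial (Fin (n + 1)) (Polynomial K)}
    (hQ : toRatFunc Q ∈ homogenizedIdeal (functionRelations F)) (d : ℕ) :
    aeval (fun i => ((Fin.cons 1 F : Fin (n + 1) → PowerSeries K) i : LaurentSeries K))
      (toRatFunc (homogeneousComponent d Q)) = 0 := by
  have h1 := homogeneousComponent_mem_of_mem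
    (isHomogeneous_homogenizedIdeal (functionRelations F)) hQ d
  rw [toRatFunc, homogeneousComponent_map] at h1
  have h2 : aeval (fun i => (F i : LaurentSeries K)) _ = 0 :=
    dehomogenize_mem_of_mem_homogenizedIdeal h1
  rw [aeval_dehomogenize] at h2
  rw [coe_cons_one]
  exact h2

theorem mem_homogenizedIdeal_valueRelations {E : Type*} [Field E] [Algebra K E] {v : Fin n → E}
    {P : MvPolynomial (Fin (n + 1)) K} {d : ℕ} (hP : P.IsHomogeneous d)
    (hv : aeval (Fin.cons 1 v : Fin (n + 1) → E) P = 0) :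
    P ∈ homogenizedIdeal (valueRelations K v) := by
  refine Ideal.subset_span ⟨⟨d, hP⟩, ?_⟩
  change aeval v _ = 0
  rwa [aeval_dehomogenize]

theorem evIdeal_le_homogenizedIdeal {E : Type*} [Field E] [Algebra K E] {v : Fin n → E} {α : K}
    (hspec : ∀ q : MvPolynomial (Fin (n + 1)) (Polynomial K),
      aeval (fun i => ((Fin.cons 1 F : Fin (n + 1) → PowerSeries K) i : LaurentSeries K))
        (toRatFunc q) = 0 → aeval (Fin.cons 1 v : Fin (n + 1) → E) (evAt α q) = 0) :
    evIdeal α (homogenizedIdeal (functionRelations F)) ≤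
      homogenizedIdeal (valueRelations K v) := by
  refine Ideal.map_le_iff_le_comap.2 fun Q hQ => ?_
  rw [Ideal.mem_comap, ← sum_homogeneousComponent Q, map_sum]
  refine Ideal.sum_mem _ fun d _ => ?_
  exact mem_homogenizedIdeal_valueRelations
    ((homogeneousComponent_isHomogeneous d Q).map (Polynomial.evalRingHom α))
    (hspec _ (aeval_homogeneousComponent_eq_zero hQ d))

theorem homogeneousRelationsLift_of_le {E : Type*} [Field E] [Algebra K E] {v : Fin n → E} {α : K}
    (h : homogenizedIdeal (valueRelations K v) ≤
      evIdeal α (homogenizedIdeal (functionRelations F))) :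
    HomogeneousRelationsLift (Fin.cons 1 F : Fin (n + 1) → PowerSeries K)
      (Fin.cons 1 v : Fin (n + 1) → E) α := by
  rintro P ⟨d, hP⟩ hPv
  have hsurj : Function.Surjective (evAt (m := n + 1) α) :=
    map_surjective _ fun a => ⟨Polynomial.C a, by simp⟩
  -- Since `evAt α` is surjective, the ideal generated by the image is the image itself. The
  -- preimage `Q` need not be homogeneous; its component of degree `d` has the same specialization.
  obtain ⟨Q, hQ, rfl⟩ := (Ideal.mem_map_iff_of_surjective _ hsurj).1
    (h (mem_homogenizedIdeal_valueRelations hP hPv))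
  refine ⟨homogeneousComponent d Q, ⟨d, homogeneousComponent_isHomogeneous d Q⟩,
    aeval_homogeneousComponent_eq_zero hQ d, ?_⟩
  rw [evAt, ← homogeneousComponent_map]
  exact homogeneousComponent_eq_self hP

end HomogenizedIdeals

/-! ### The constant function `1` -/

section Constants

variable {C : Type*} [NontriviallyNormedField C]

theorem isAnalyticOnDomain_one {U : Set C} : IsAnalyticOnDomain (1 : C → C) U := by
  by_cases h : IsUltrametricDist C
  · exact Or.inr ⟨h, fun D _ _ => by
      simpa [Pi.one_def] using isUniformLimitOfRational_eval (1 : Polynomial C) D⟩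
  · exact Or.inl ⟨h, analyticOnNhd_const⟩

theorem isExpansionAtZero_one {K : Type*} [Field K] [Algebra K C] :
    IsExpansionAtZero (1 : PowerSeries K) (1 : C → C) := by
  simpa [Pi.one_def] using isExpansionAtZero_polynomial (C := C) (1 : Polynomial K)

end Constants

/-! ### Conclusion -/

section NonRegular

open scoped RatFunc

variable {K C : Type*} [Field K] [NontriviallyNormedField C] [CompleteSpace C] [Algebra K C]
  {U : Set C} {n : ℕ} {f : Fin n → C → C} {F : Fin n → PowerSeries K} {α : K}

/-- Relations between the functions specialize to relations between their values. -/
theorem aeval_evAt_eq_zero (halg : IsUltrametricDist C → IsAlgClosed C) (hU : IsAnalyticDomain U)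
    (h0 : (0 : C) ∈ U) (hf : ∀ i, IsAnalyticOnDomain (f i) U)
    (hF : ∀ i, IsExpansionAtZero (F i) (f i)) (hα : algebraMap K C α ∈ U)
    {q : MvPolynomial (Fin (n + 1)) (Polynomial K)}
    (hq : MvPolynomial.aeval
      (fun i => ((Fin.cons 1 F : Fin (n + 1) → PowerSeries K) i : LaurentSeries K))
        (toRatFunc q) = 0) :
    MvPolynomial.aeval (Fin.cons 1 (fun i => f i (algebraMap K C α)) : Fin (n + 1) → C)
      (evAt α q) = 0 := by
  have h := evalAlong_eq_zero (f := (Fin.cons 1 f : Fin (n + 1) → C → C)) halg hU h0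
    (Fin.cases isAnalyticOnDomain_one hf) (Fin.cases isExpansionAtZero_one hF) hq hα
  rw [evalAlong_algebraMap] at h
  rw [← h]
  congr 2
  ext i
  refine Fin.cases ?_ (fun i => ?_) i <;> simp

theorem evIdeal_lt_and_not_homogeneousRelationsLift [IsAlgClosed K]
    (halg : IsUltrametricDist C → IsAlgClosed C) (hU : IsAnalyticDomain U)
    (h0 : (0 : C) ∈ U) (hf : ∀ i, IsAnalyticOnDomain (f i) U)
    (hF : ∀ i, IsExpansionAtZero (F i) (f i)) (hreg : ¬ IsRegularFunctionField F)
    (hα : algebraMap K C α ∈ U) :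
    evIdeal α (homogenizedIdeal (functionRelations F)) <
        homogenizedIdeal (valueRelations K fun i => f i (algebraMap K C α)) ∧
      ¬ HomogeneousRelationsLift (Fin.cons 1 F : Fin (n + 1) → PowerSeries K)
        (Fin.cons 1 (fun i => f i (algebraMap K C α)) : Fin (n + 1) → C) α := by
  have hspec := fun q => aeval_evAt_eq_zero (q := q) halg hU h0 hf hF hα
  have hlift := mt (isRegularFunctionField_of_lift F _ α hspec) hreg
  exact ⟨lt_of_le_not_ge (evIdeal_le_homogenizedIdeal hspec)
    (mt homogeneousRelationsLift_of_le hlift), hlift⟩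

end NonRegular

end

theorem theorem5 {k C : Type*} [NontriviallyNormedField k] [NontriviallyNormedField C]
    [NormedAlgebra k C] (hC : IsCompletedAlgClosure k C)
    (U : Set C) (hU : IsAnalyticDomain U) (h0 : (0 : C) ∈ U)
    {n : ℕ} (f : Fin n → C → C) (hf : ∀ i, IsAnalyticOnDomain (f i) U)
    (F : Fin n → PowerSeries (algebraicClosure k C)) (hF : ∀ i, IsExpansionAtZero (F i) (f i))
    (hreg : ¬ IsRegularFunctionField F)
    (α : algebraicClosure k C) (hα : (α : C) ∈ U) :
    evIdeal α (homogenizedIdeal (functionRelations F)) <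
        homogenizedIdeal (valueRelations (algebraicClosure k C) fun i => f i (α : C)) ∧
      ¬ HomogeneousRelationsLift (Fin.cons 1 F : Fin (n + 1) → PowerSeries (algebraicClosure k C))
        (Fin.cons 1 (fun i => f i (α : C)) : Fin (n + 1) → C) α := by
  have := hC.complete
  have := hC.isAlgClosed_algebraicClosure
  exact evIdeal_lt_and_not_homogeneousRelationsLift
    (fun _ => hC.isAlgClosed_of_isUltrametricDist) hU h0 hf hF hreg hα
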